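/- Let $n \ge m \ge 1$ be integers and let $\mathbf{y} = \mathbf{H}\mathbf{s} + \mathbf{v}$, where $\mathbf{H} \in \mathbb{R}^{n\times m}$ has i.i.d. Gaussian entries of zero mean and fixed nonzero variance, $\mathbf{s}$ is uniformly distributed on $\{\pm 1\}^m$, $\mathbf{v} \in \mathbb{R}^n$ has i.i.d. Gaussian entries of zero mean and variance $\rho^{-1}$, and $\mathbf{H}, \mathbf{s}, \mathbf{v}$ are independent. The maximum likelihood (ML) detector knows $\mathbf{H}$ and $\mathbf{y}$ and outputs a minimizer $\hat{\mathbf{s}}_{\mathrm{ML}}$ of $\|\mathbf{y}-\mathbf{H}\mathbf{x}\|^2$ (Euclidean norm) over $\mathbf{x} \in \{\pm 1\}^m$. The semidefinite relaxation (SDR) detector selects, as a function of $\mathbf{H}$ and $\mathbf{y}$, a minimizer $\mathbf{X}^\star$ of $\mathrm{Tr}(\mathbf{L}\mathbf{X})$ over all symmetric positive semidefinite $\mathbf{X} \in \mathbb{R}^{(m+1)\times(m+1)}$ with all diagonal entries equal to $1$, where $$\mathbf{L} = \begin{bmatrix} \mathbf{H}^{\mathrm T}\mathbf{H} & -\mathbf{H}^{\mathrm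 T}\mathbf{y} \\ -\mathbf{y}^{\mathrm T}\mathbf{H} & \mathbf{y}^{\mathrm T}\mathbf{y} \end{bmatrix},$$ and outputs $[\hat{\mathbf{s}}_{\mathrm{SDR}}]_i = \mathrm{sgn}([\mathbf{X}^\star]_{i,m+1})$ for $i = 1,\dots,m$, where $\mathrm{sgn}(x) = 1$ if $x > 0$ and $\mathrm{sgn}(x) = -1$ if $x \le 0$. Then, for every choice of the minimizers in the two detectors, $$\lim_{\rho\to\infty} \frac{\ln P(\hat{\mathbf{s}}_{\mathrm{SDR}} \ne \mathbf{s})}{\ln \rho} = \lim_{\rho\to\infty} \frac{\ln P(\hat{\mathbf{s}}_{\mathrm{ML}} \ne \mathbf{s})}{\ln \rho} = -\frac{n}{2}.$$ -/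

import Mathlib

open MeasureTheory ProbabilityTheory Filter Topology
open scoped NNReal

/-- The set `{±1}^m` of possible messages, as vectors in `ℝ^m`. -/
def messages (m : ℕ) : Set (Fin m → ℝ) := {s | ∀ i, s i = 1 ∨ s i = -1}

/-- A detector maps the channel matrix `H` and the received vector `y` to an estimate of the
transmitted message. -/
abbrev Detector (n m : ℕ) : Type :=
  Matrix (Fin n) (Fin m) ℝ → (Fin n → ℝ) → (Fin m → ℝ)

/-- The maximum likelihood objective, the squared Euclidean norm `‖y - H x‖²`. -/
noncomputable def mlObjective {n m : ℕ} (H : Matrix (Fin n) (Fin m) ℝ) (y : Fin n → ℝ)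
    (x : Fin m → ℝ) : ℝ :=
  ‖WithLp.toLp 2 (y - H.mulVec x)‖ ^ 2

/-- `d` is a maximum likelihood detector: for all `H` and `y` its output is a minimizer of
`‖y - H x‖²` over `x ∈ {±1}^m` (ties are broken in an arbitrary way). -/
def IsMLDetector {n m : ℕ} (d : Detector n m) : Prop :=
  ∀ H y, d H y ∈ messages m ∧ IsMinOn (mlObjective H y) (messages m) (d H y)

/-- The `(m+1) × (m+1)` matrix `L = [HᵀH, -Hᵀy; -yᵀH, yᵀy]`. The index `Sum.inr ()` is the last
row or column. -/
def sdpMatrix {n m : ℕ} (H : Matrix (Fin n) (Fin m) ℝ) (y : Fin n → ℝ) :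
    Matrix (Fin m ⊕ Unit) (Fin m ⊕ Unit) ℝ :=
  let Y : Matrix (Fin n) Unit ℝ := Matrix.replicateCol Unit y
  Matrix.fromBlocks (H.transpose * H) (-(H.transpose * Y)) (-(Y.transpose * H)) (Y.transpose * Y)

/-- The feasible set of the semidefinite relaxation: symmetric positive semidefinite matrices with
all diagonal entries equal to one. -/
def sdpFeasible (m : ℕ) : Set (Matrix (Fin m ⊕ Unit) (Fin m ⊕ Unit) ℝ) :=
  {X | X.PosSemidef ∧ ∀ i, X i i = 1}

/-- `X` is an optimal point of the program: minimize `Tr (L X)` subject to `diag X = e`, `X ⪰ 0`. -/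
def IsSDPOptimal {n m : ℕ} (H : Matrix (Fin n) (Fin m) ℝ) (y : Fin n → ℝ)
    (X : Matrix (Fin m ⊕ Unit) (Fin m ⊕ Unit) ℝ) : Prop :=
  X ∈ sdpFeasible m ∧ IsMinOn (fun Z => (sdpMatrix H y * Z).trace) (sdpFeasible m) X

/-- The sign used for rounding, with `sgn 0 = -1`. -/
noncomputable def sgn (x : ℝ) : ℝ := if 0 < x then 1 else -1

/-- `d` is a semidefinite relaxation detector: for all `H` and `y` its output consists of the signs
of (the first `m` entries of) the last column of an optimal point selected from the optimal set. -/
def IsSDRDetector {n m : ℕ} (d : Detector n m) : Prop :=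
  ∃ Xstar : Matrix (Fin n) (Fin m) ℝ → (Fin n → ℝ) → Matrix (Fin m ⊕ Unit) (Fin m ⊕ Unit) ℝ,
    (∀ H y, IsSDPOptimal H y (Xstar H y)) ∧
    ∀ H y i, d H y i = sgn (Xstar H y (Sum.inl i) (Sum.inr ()))

/-- The joint law of the entries of an `n × m` matrix that are i.i.d. Gaussian of mean zero and
variance `v`. -/
noncomputable def channelLaw (n m : ℕ) (v : ℝ≥0) : Measure (Fin n → Fin m → ℝ) :=
  Measure.pi fun _ : Fin n => Measure.pi fun _ : Fin m => gaussianReal 0 v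

/-- The law of a message that is uniformly distributed on `{±1}^m`. -/
noncomputable def messageLaw (m : ℕ) : Measure (Fin m → ℝ) := uniformOn (messages m)

/-- The law of white Gaussian noise in `ℝ^n` with variance `ρ⁻¹` per component. -/
noncomputable def noiseLaw (n : ℕ) (ρ : ℝ) : Measure (Fin n → ℝ) :=
  Measure.pi fun _ => gaussianReal 0 (Real.toNNReal ρ⁻¹)

/-- The probability of error of the detector `d` at signal to noise ratio `ρ`: the probability that
the estimate computed from `H` and `y = H s + w` differs from `s`, where the channel `H`, the
message `s` and the noise `w` are independent. -/
noncomputable def errorProb {n m : ℕ} (v : ℝ≥0) (d : Detector n m) (ρ : ℝ) : ℝ :=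
  ((channelLaw n m v).prod ((messageLaw m).prod (noiseLaw n ρ))).real
    {p | d (Matrix.of p.1) ((Matrix.of p.1).mulVec p.2.1 + p.2.2) ≠ p.2.1}

/-!
Both detectors lose exactly a factor `ρ ^ (-n / 2)`, up to powers of `log ρ`.

*Lower bound, for every detector* (`le_errorProb`). With probability of order `ρ ^ (-n / 2)` the
first column of the channel is no longer than the noise. Then two messages that differ in the first
entry only produce received vectors whose laws both dominate a common measure, so any detector,
measurable or not, errs under the two together with at least the mass of that measure.

*Upper bound* (`ErrsOnlyIfConfused.errorProb_le`). If either detector errs, there are unit vectors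
`w i`, `w₀` (for the relaxation, Gram vectors of the optimal `X`) such that `u i = s i • w i - w₀`
satisfy `‖∑ s i H r i u i‖ ≤ 2 ‖v‖` for every row `r` of the channel, while some `u j` has length at
least `√2`. The `u i` lie on the unit sphere with centre `-w₀`, which passes through the origin.
Pivoted Gram–Schmidt (`exists_pivoted_triangular_coordinates`) turns them into the rows of a lower
triangular matrix `Z` whose diagonal entries `d l` dominate their columns. Scaling to `d 0 = 1` and
rounding on the scale `1 / N` with `N ≈ √ρ` gives an integer matrix `B`, a *code*, with diagonal
`N + 1, D 0, …, D (k - 1)`, where `k + 1` is the number of entries of a message. For a given code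
the channel must satisfy `|H B| ≲ log ρ`, which by the boundedness of the Gaussian density has
probability at most `polylog / (N ∏ D) ^ n` (`channelLaw_abs_sum_le`).

What makes the union bound over the codes work is the count of the codes with given `D`, at most a
constant times `(∏ D) ^ k` (`sum_card_piFinset_codeRows_le`). The entries after the first of each
row range over a box of size `∏ D`, and so does the rounded centre of the sphere; the sphere equation
then leaves boundedly many first entries. Where the equation is degenerate in the first entry, `D 0`
is of order `N`, and one counts the first two entries together: an annulus whose squared radii differ
by `O(N)` contains `O(N)` lattice points (`card_lattice_annulus_le`). As `k + 1 ≤ n`, the sum of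
`(∏ D) ^ k / (∏ D) ^ n` over `D` is at most a power of a harmonic sum, and a factor
`N ^ (-n) ≈ ρ ^ (-n / 2)` remains.
-/

/-! ### Pivoted triangularization of a family of vectors -/

/-- Gram–Schmidt orthogonalization with pivoting, in coordinates. The vectors `u i`, reordered by
`σ` so that each step picks a vector whose residual is longest, get coordinates `Z i l` that form a
lower triangular matrix in which the diagonal entry `Z l l` dominates every entry in the columns
from `l` on; `a` holds the coordinates of the projection of the extra vector `x`. -/
theorem exists_pivoted_triangular_coordinates {E : Type*} [NormedAddCommGroup E]
    [InnerProductSpace ℝ E] (k : ℕ) : ∀ {ι : Type} [Fintype ι] (_ : Fintype.card ι = k) (u : ι → E)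
    (x : E), ∃ (σ : Fin k → ι) (Z : Matrix (Fin k) (Fin k) ℝ) (a : Fin k → ℝ),
      Function.Injective σ ∧
      (∀ i l, i < l → Z i l = 0) ∧
      (∀ i l l', l ≤ l' → |Z i l'| ≤ Z l l) ∧
      (∀ i l : Fin k, (l : ℕ) = 0 → ‖u (σ i)‖ ≤ Z l l) ∧
      (∀ i j, inner ℝ (u (σ i)) (u (σ j)) = ∑ l, Z i l * Z j l) ∧
      (∀ i, inner ℝ (u (σ i)) x = ∑ l, Z i l * a l) ∧
      (∀ l, |a l| ≤ ‖x‖) := by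
  induction k with
  | zero =>
    intro ι _ hι u x
    exact ⟨Fin.elim0, 0, 0, fun i => i.elim0, fun i => i.elim0, fun i => i.elim0, fun i => i.elim0,
      fun i => i.elim0, fun i => i.elim0, fun i => i.elim0⟩
  | succ k ih =>
    intro ι _ hι u x
    classical
    have : Nonempty ι := Fintype.card_pos_iff.1 (by omega)
    obtain ⟨p, hp⟩ := Finite.exists_max (fun i => ‖u i‖)
    -- when `u p = 0` this is `e = 0`, and every step below still makes sense
    set e : E := (‖u p‖)⁻¹ • u p with he
    have hee : ∀ y z : E, inner ℝ y z = inner ℝ e y * inner ℝ e z +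
        inner ℝ (y - (inner ℝ e y : ℝ) • e) (z - (inner ℝ e z : ℝ) • e) := by
      intro y z
      have h1 : (inner ℝ e y : ℝ) * (inner ℝ e z * inner ℝ e e) = inner ℝ e y * inner ℝ e z := by
        rcases eq_or_ne (u p) 0 with h | h
        · simp [he, h]
        · have : (inner ℝ e e : ℝ) = 1 := by
            rw [real_inner_self_eq_norm_sq, he, norm_smul]
            have := norm_ne_zero_iff.2 h
            simp [this]
          rw [this, mul_one]
      simp only [inner_sub_left, inner_sub_right, inner_smul_left, inner_smul_right,
        real_inner_comm e y]
      simp only [RCLike.conj_to_real]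
      linarith
    have hpe : inner ℝ e (u p) = ‖u p‖ := by
      rw [he, inner_smul_left, real_inner_self_eq_norm_sq]
      rcases eq_or_ne ‖u p‖ 0 with h | h
      · simp [h]
      · simp [sq, h]
    have hpres : u p - (inner ℝ e (u p) : ℝ) • e = 0 := by
      rw [hpe, he, smul_smul]
      rcases eq_or_ne ‖u p‖ 0 with h | h
      · simp [norm_eq_zero.1 h]
      · simp [h]
    have hen : ‖e‖ ≤ 1 := by
      rw [he, norm_smul, norm_inv, norm_norm]
      exact inv_mul_le_one
    have hres : ∀ y : E, ‖y - (inner ℝ e y : ℝ) • e‖ ≤ ‖y‖ := by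
      intro y
      have := hee y y
      rw [real_inner_self_eq_norm_sq, real_inner_self_eq_norm_sq] at this
      nlinarith [norm_nonneg y, mul_self_nonneg (inner ℝ e y : ℝ), abs_le_of_sq_le_sq'
        (show ‖y - (inner ℝ e y : ℝ) • e‖ ^ 2 ≤ ‖y‖ ^ 2 by nlinarith) (norm_nonneg y)]
    have hin : ∀ y : E, |inner ℝ e y| ≤ ‖y‖ := fun y =>
      (abs_real_inner_le_norm e y).trans (mul_le_of_le_one_left (norm_nonneg y) hen)
    have hcard : Fintype.card {i : ι // i ≠ p} = k := by
      rw [Fintype.card_subtype_compl, Fintype.card_subtype_eq]; omega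
    obtain ⟨σ, Z, a, hσ, hlow, hdom, hnorm, hG, ha, ha1⟩ := ih hcard
      (fun i => u i - (inner ℝ e (u i) : ℝ) • e) (x - (inner ℝ e x : ℝ) • e)
    have hZle : ∀ i l, |Z i l| ≤ ‖u p‖ := by
      intro i l
      have h1 := hG i i
      rw [real_inner_self_eq_norm_sq] at h1
      have h2 : Z i l * Z i l ≤ ∑ l, Z i l * Z i l :=
        Finset.single_le_sum (f := fun l => Z i l * Z i l) (fun j _ => mul_self_nonneg _)
          (Finset.mem_univ l)
      have h3 := (hres (u (σ i))).trans (hp (σ i))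
      apply abs_le_of_sq_le_sq _ (norm_nonneg _)
      nlinarith [norm_nonneg (u (σ i) - (inner ℝ e (u (σ i)) : ℝ) • e)]
    let τ : Fin (k + 1) → ι := Fin.cons p (fun i => (σ i : ι))
    let Y : Matrix (Fin (k + 1)) (Fin (k + 1)) ℝ := fun i =>
      Fin.cons (inner ℝ e (u (τ i))) (Fin.cases (fun _ => 0) (fun i => Z i) i : Fin k → ℝ)
    refine ⟨τ, Y, Fin.cons (inner ℝ e x) a, ?_, ?_, ?_, ?_, ?_, ?_, ?_⟩
    · rw [Fin.cons_injective_iff]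
      refine ⟨?_, Subtype.val_injective.comp hσ⟩
      rintro ⟨i, hi⟩
      exact (σ i).2 hi
    · intro i l hil
      cases l using Fin.cases with
      | zero => exact absurd hil (Fin.not_lt_zero i)
      | succ l =>
        cases i using Fin.cases with
        | zero => simp [Y]
        | succ i => simpa [Y] using hlow i l (Fin.succ_lt_succ_iff.1 hil)
    · intro i l l' hll
      cases l using Fin.cases with
      | zero =>
        have h0 : Y 0 0 = ‖u p‖ := by simp [Y, τ, hpe]
        rw [h0]
        cases l' using Fin.cases with
        | zero => exact (hin _).trans (hp _)
        | succ l' =>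
          cases i using Fin.cases with
          | zero => simp [Y]
          | succ i => simpa [Y] using hZle i l'
      | succ l =>
        cases l' using Fin.cases with
        | zero => exact absurd hll (by simp)
        | succ l' =>
          have hll' := Fin.succ_le_succ_iff.1 hll
          cases i using Fin.cases with
          | zero =>
            simpa [Y] using (abs_nonneg _).trans (hdom l l l le_rfl)
          | succ i => simpa [Y] using hdom i l l' hll'
    · intro i l hl
      obtain rfl : l = 0 := Fin.ext hl
      have h0 : Y 0 0 = ‖u p‖ := by simp [Y, τ, hpe]
      rw [h0]
      exact hp _
    · intro i j
      rw [Fin.sum_univ_succ, hee]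
      cases i using Fin.cases with
      | zero => simp [Y, τ, hpres]
      | succ i =>
        cases j using Fin.cases with
        | zero => simp [Y, τ, hpres]
        | succ j => simpa [Y, τ] using hG i j
    · intro i
      rw [Fin.sum_univ_succ, hee]
      cases i using Fin.cases with
      | zero => simp [Y, τ, hpres]
      | succ i => simpa [Y, τ] using ha i
    · intro l
      cases l using Fin.cases with
      | zero => simpa using hin x
      | succ l => simpa using (ha1 l).trans (hres x)

/-! ### Errors of the two detectors -/

/-- The trace objective at a Gram matrix is the squared distance between the rows of the channel
acting on the Gram vectors and the received vector placed along the last one. -/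
theorem trace_sdpMatrix_mul_gram {n m : ℕ} {E : Type*} [NormedAddCommGroup E]
    [InnerProductSpace ℝ E] (H : Matrix (Fin n) (Fin m) ℝ) (y : Fin n → ℝ) (w : Fin m ⊕ Unit → E)
    (X : Matrix (Fin m ⊕ Unit) (Fin m ⊕ Unit) ℝ) (hX : ∀ i j, X i j = inner ℝ (w i) (w j)) :
    (sdpMatrix H y * X).trace =
      ∑ r, ‖∑ i, H r i • w (Sum.inl i) - y r • w (Sum.inr ())‖ ^ 2 := by
  have hL : ∀ i j, sdpMatrix H y i j = ∑ r, (Sum.elim (H r) (fun _ => -y r) i) *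
      (Sum.elim (H r) (fun _ => -y r) j) := by
    rintro (i | i) (j | j) <;>
      simp [sdpMatrix, Matrix.mul_apply, Matrix.replicateCol_apply, Matrix.transpose_apply,
        Matrix.neg_apply]
  have hR : ∀ r, ∑ i, H r i • w (Sum.inl i) - y r • w (Sum.inr ()) =
      ∑ i, (Sum.elim (H r) (fun _ => -y r) i) • w i := by
    intro r
    simp [Fintype.sum_sum_type, sub_eq_add_neg]
  simp only [hR, ← real_inner_self_eq_norm_sq, sum_inner, inner_sum, inner_smul_left,
    inner_smul_right, Matrix.trace, Matrix.diag, Matrix.mul_apply, hL, hX, Finset.sum_mul]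
  simp only [RCLike.conj_to_real]
  rw [Finset.sum_comm' (t' := Finset.univ) (s' := fun _ => Finset.univ) (by simp)]
  conv_lhs => enter [2, x]; rw [Finset.sum_comm]
  rw [Finset.sum_comm]
  simp only [Finset.mul_sum]
  refine Finset.sum_congr rfl fun r _ => Finset.sum_congr rfl fun i _ =>
    Finset.sum_congr rfl fun j _ => ?_
  rw [real_inner_comm]
  ring

/-- The Gram vectors `w` fit the received vector `H s + v` at least as well as `s` does, while
rounding them gets some entry of `s` wrong. -/
def IsConfusing {n m : ℕ} {E : Type*} [NormedAddCommGroup E] [InnerProductSpace ℝ E]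
    (H : Matrix (Fin n) (Fin m) ℝ) (s : Fin m → ℝ) (v : Fin n → ℝ) (w : Fin m → E) (w₀ : E) :
    Prop :=
  ‖w₀‖ = 1 ∧ (∀ i, ‖w i‖ = 1) ∧
    ∑ r, ‖∑ i, H r i • w i - (H.mulVec s + v) r • w₀‖ ^ 2 ≤ ∑ r, v r ^ 2 ∧
    ∃ j, s j * inner ℝ (w j) w₀ ≤ 0

theorem IsMLDetector.exists_isConfusing {n m : ℕ} {d : Detector n m} (hd : IsMLDetector d)
    {H : Matrix (Fin n) (Fin m) ℝ} {s : Fin m → ℝ} (hs : s ∈ messages m) {v : Fin n → ℝ}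
    (h : d H (H.mulVec s + v) ≠ s) : ∃ (w : Fin m → ℝ) (w₀ : ℝ), IsConfusing H s v w w₀ := by
  obtain ⟨hx, hmin⟩ := hd H (H.mulVec s + v)
  set x := d H (H.mulVec s + v)
  have hle := hmin hs
  simp only [mlObjective, EuclideanSpace.norm_sq_eq, Set.mem_ofPred_eq] at hle
  refine ⟨x, 1, by simp, fun i => ?_, ?_, ?_⟩
  · rcases hx i with h | h <;> simp [h]
  · have h1 : ∀ r, ∑ i, H r i • x i - (H.mulVec s + v) r • (1 : ℝ) =
        -((H.mulVec s + v - H.mulVec x) r) := by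
      intro r
      simp [Matrix.mulVec, dotProduct]
    simp only [h1, norm_neg]
    refine hle.trans_eq (Finset.sum_congr rfl fun r _ => ?_)
    simp
  · obtain ⟨j, hj⟩ := Function.ne_iff.1 h
    refine ⟨j, ?_⟩
    rcases hx j with h1 | h1 <;> rcases hs j with h2 | h2 <;> simp_all

theorem IsSDRDetector.exists_isConfusing {n m : ℕ} {d : Detector n m} (hd : IsSDRDetector d)
    {H : Matrix (Fin n) (Fin m) ℝ} {s : Fin m → ℝ} (hs : s ∈ messages m) {v : Fin n → ℝ}
    (h : d H (H.mulVec s + v) ≠ s) :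
    ∃ (w : Fin m → EuclideanSpace ℝ (Fin m ⊕ Unit)) (w₀ : EuclideanSpace ℝ (Fin m ⊕ Unit)),
      IsConfusing H s v w w₀ := by
  obtain ⟨Xs, hopt, hd⟩ := hd
  obtain ⟨⟨hpsd, hdiag⟩, hmin⟩ := hopt H (H.mulVec s + v)
  set X := Xs H (H.mulVec s + v) with hXdef
  obtain ⟨B, hB⟩ : ∃ B, X = Matrix.conjTranspose B * B := by
    open scoped MatrixOrder in
    exact CStarAlgebra.nonneg_iff_eq_star_mul_self.1 hpsd.nonneg
  let w : Fin m ⊕ Unit → EuclideanSpace ℝ (Fin m ⊕ Unit) := fun i =>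
    WithLp.toLp 2 (fun l => B l i)
  have hX : ∀ i j, X i j = inner ℝ (w i) (w j) := by
    intro i j
    rw [hB]
    simp [Matrix.mul_apply, w, PiLp.inner_apply, mul_comm]
  have hw : ∀ i, ‖w i‖ = 1 := by
    intro i
    have := hdiag i
    rw [hX, real_inner_self_eq_norm_sq] at this
    nlinarith [norm_nonneg (w i)]
  let t : Fin m ⊕ Unit → ℝ := Sum.elim s 1
  have ht : ∀ i, t i * t i = 1 := by
    rintro (i | i)
    · rcases hs i with h | h <;> simp [t, h]
    · simp [t]
  let Y : Matrix (Fin m ⊕ Unit) (Fin m ⊕ Unit) ℝ := fun i j => t i * t j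
  have hY : Y ∈ sdpFeasible m := by
    refine ⟨?_, ht⟩
    have := Matrix.posSemidef_vecMulVec_self_star t
    convert this using 1
    ext i j
    simp [Y, Matrix.vecMulVec_apply]
  have hle := hmin hY
  simp only [Set.mem_ofPred_eq] at hle
  rw [trace_sdpMatrix_mul_gram H _ w X hX, trace_sdpMatrix_mul_gram H _ t Y
    (fun i j => by simp [Y, mul_comm])] at hle
  refine ⟨fun i => w (Sum.inl i), w (Sum.inr ()), hw _, fun i => hw _, hle.trans_eq ?_, ?_⟩
  · refine Finset.sum_congr rfl fun r _ => ?_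
    simp [t, Matrix.mulVec, dotProduct]
  · obtain ⟨j, hj⟩ := Function.ne_iff.1 h
    refine ⟨j, ?_⟩
    rw [hd, ← hXdef, hX] at hj
    unfold sgn at hj
    rcases hs j with h1 | h1 <;> rw [h1] at hj ⊢ <;> split_ifs at hj with h2 <;> simp_all
    exact h2.le

/-! ### Integer codes for confusing configurations -/

/-- The (rescaled) equation of the sphere that passes through the origin and has centre
`-(a₀, …, a_k)` with `a₀ = -N / 2` and `a_{l+1} = N A_l / D_l`, at the integer point `b`. -/
noncomputable def sphereForm {k : ℕ} (N : ℕ) (D : Fin k → ℕ) (A : Fin k → ℤ)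
    (b : Fin (k + 1) → ℤ) : ℝ :=
  (b 0 : ℝ) ^ 2 - N * b 0 + ∑ l, ((b l.succ : ℝ) ^ 2 + 2 * N * (A l / D l) * b l.succ)

/-- An integer approximation, on the scale `1 / N`, of the triangular coordinates of a confusing
configuration: `B` holds the coordinates, `D` the diagonal of `B` after its first entry, and `A`
the centre of the sphere through the rows. -/
structure IsCode {k : ℕ} (C : ℝ) (N : ℕ) (D : Fin k → ℕ) (A : Fin k → ℤ)
    (B : Matrix (Fin (k + 1)) (Fin (k + 1)) ℤ) : Prop where
  one_le : ∀ l, 1 ≤ D l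
  le_add_one : ∀ l, D l ≤ N + 1
  antitone : ∀ l l', l ≤ l' → D l' ≤ D l
  abs_center : ∀ l, |A l| ≤ D l
  lower : ∀ i l, i < l → B i l = 0
  corner : B 0 0 = N + 1
  diag : ∀ l : Fin k, B l.succ l.succ = D l
  abs_zero : ∀ i, |B i 0| ≤ N + 1
  abs_succ : ∀ i (l : Fin k), |B i l.succ| ≤ D l
  sphere : ∀ i, i ≠ 0 → |sphereForm N D A (B i)| ≤ C * N

theorem abs_round_le_floor_add_one {x d : ℝ} (h : |x| ≤ d) : |round x| ≤ ⌊d⌋ + 1 := by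
  have h1 := abs_sub_round x
  have h2 := Int.lt_floor_add_one d
  rw [abs_le] at h h1 ⊢
  constructor
  · have : (-(⌊d⌋ + 1) - 1 : ℤ) < round x := by
      rify; linarith
    omega
  · have : round x < (⌊d⌋ + 1 + 1 : ℤ) := by
      rify; linarith
    omega

/-- Rounding the triangular coordinates gives a code. The pivot entries are rounded up to keep the
determinant away from zero. -/
theorem exists_isCode_of_sphere {k N : ℕ} (hN : 1 ≤ N) (Z : Matrix (Fin (k + 1)) (Fin (k + 1)) ℝ)
    (a : Fin (k + 1) → ℝ) (hlow : ∀ i l, i < l → Z i l = 0)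
    (hdom : ∀ i l l', l ≤ l' → |Z i l'| ≤ Z l l) (hZ0 : Z 0 0 = 1) (ha : ∀ l, |a l| ≤ 1)
    (ha0 : a 0 = -1 / 2) (hsph : ∀ i, ∑ l, (Z i l ^ 2 + 2 * (Z i l * a l)) = 0) :
    ∃ D A B, IsCode (7 * (k + 1)) N D A B ∧ ∀ i l, |(B i l : ℝ) - N * Z i l| ≤ 1 := by
  have hN' : (1 : ℝ) ≤ N := by exact_mod_cast hN
  have hZ1 : ∀ l, Z l l ≤ 1 := fun l => (le_abs_self _).trans (hZ0 ▸ hdom l 0 l (Fin.zero_le l))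
  have hZp : ∀ l, 0 ≤ Z l l := fun l => (abs_nonneg _).trans (hdom l l l le_rfl)
  let D : Fin (k + 1) → ℕ := fun l => ⌊N * Z l l⌋₊ + 1
  have hDf : ∀ l, (D l : ℤ) = ⌊N * Z l l⌋ + 1 := fun l => by
    simp [D, Int.natCast_floor_eq_floor (mul_nonneg (Nat.cast_nonneg N) (hZp l))]
  have hDz : ∀ l, N * Z l l ≤ D l := fun l => by
    have := (Nat.lt_floor_add_one (N * Z l l)).le
    simpa [D] using this
  have hDN : ∀ l, D l ≤ N + 1 := fun l => by
    simp only [D, add_le_add_iff_right]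
    exact Nat.floor_le_of_le (mul_le_of_le_one_right (by positivity) (hZ1 l))
  have hD1 : ∀ l, 1 ≤ D l := fun l => Nat.le_add_left _ _
  let B : Matrix (Fin (k + 1)) (Fin (k + 1)) ℤ := fun i l =>
    if i = l then D l else round (N * Z i l)
  have hx : ∀ i l, |N * Z i l| ≤ N * Z l l := fun i l => by
    rw [abs_mul, Nat.abs_cast]
    exact mul_le_mul_of_nonneg_left (hdom i l l le_rfl) (by positivity)
  have hB : ∀ i l, |B i l| ≤ D l := fun i l => by
    simp only [B]
    split_ifs with h
    · simp
    · rw [hDf]; exact abs_round_le_floor_add_one (hx i l)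
  have hBZ : ∀ i l, |(B i l : ℝ) - N * Z i l| ≤ 1 := fun i l => by
    simp only [B]
    split_ifs with h
    · subst h
      have h1 := hDz i
      have h2 := Nat.floor_le (mul_nonneg (Nat.cast_nonneg N) (hZp i))
      simp only [D] at h1 ⊢
      push_cast at h1 ⊢
      rw [abs_le]; constructor <;> linarith
    · rw [abs_sub_comm]
      exact (abs_sub_round _).trans (by norm_num)
  let A : Fin (k + 1) → ℤ := fun l => round (a l * D l)
  have hD0 : ∀ l, (0 : ℝ) < D l := fun l => by exact_mod_cast hD1 l
  have hA : ∀ l, |A l| ≤ D l := fun l => by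
    have h1 : |a l * D l| ≤ D l := by
      rw [abs_mul, Nat.abs_cast]; exact mul_le_of_le_one_left (hD0 l).le (ha l)
    have h2 := abs_sub_round (a l * D l)
    rw [abs_le] at h1 h2 ⊢
    constructor
    · have : (-(D l : ℤ) - 1 : ℤ) < A l := by
        rify; simp only [A]; linarith
      omega
    · have : A l < (D l + 1 : ℤ) := by
        rify; simp only [A]; linarith
      omega
  have hAa : ∀ l, |(A l : ℝ) / D l - a l| * D l ≤ 1 / 2 := fun l => by
    rw [← abs_of_pos (hD0 l), ← abs_mul, abs_of_pos (hD0 l), sub_mul,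
      div_mul_cancel₀ _ (hD0 l).ne', abs_sub_comm]
    exact abs_sub_round _
  have hBr : ∀ i l, |(B i l : ℝ)| ≤ D l := fun i l => by exact_mod_cast hB i l
  have hDr : ∀ l, (D l : ℝ) ≤ 2 * N := fun l => by
    have : (D l : ℝ) ≤ N + 1 := by exact_mod_cast hDN l
    linarith
  have hsq : ∀ i l, |(B i l : ℝ) ^ 2 - (N * Z i l) ^ 2| ≤ 4 * N := fun i l => by
    rw [sq_sub_sq, abs_mul]
    have h1 : |(B i l : ℝ) + N * Z i l| ≤ 4 * N :=
      (abs_add_le _ _).trans (by linarith [hBr i l, hx i l, hDz l, hDr l])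
    exact (mul_le_mul h1 (hBZ i l) (abs_nonneg _) (by positivity)).trans (by simp)
  refine ⟨fun l => D l.succ, fun l => A l.succ, B, ⟨fun l => hD1 _, fun l => hDN _, ?_,
    fun l => hA _, ?_, ?_, ?_, ?_, fun i l => hB _ _, ?_⟩, hBZ⟩
  · intro l l' hl
    have := hdom l'.succ l.succ l'.succ (Fin.succ_le_succ_iff.2 hl)
    simp only [D, add_le_add_iff_right]
    exact Nat.floor_mono (mul_le_mul_of_nonneg_left ((le_abs_self _).trans this) (by positivity))
  · intro i l hil
    simp [B, hil.ne, hlow i l hil]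
  · simp [B, D, hZ0]
  · intro l; simp [B]
  · intro i
    exact (hB i 0).trans (by exact_mod_cast hDN 0)
  · intro i _
    have h0 := hsph i
    rw [Fin.sum_univ_succ, ha0] at h0
    have key : sphereForm N (fun l => D l.succ) (fun l => A l.succ) (B i) =
        ((B i 0 : ℝ) ^ 2 - ((N : ℝ) * Z i 0) ^ 2) - (N : ℝ) * (B i 0 - (N : ℝ) * Z i 0) +
        ∑ l : Fin k, (((B i l.succ : ℝ) ^ 2 - ((N : ℝ) * Z i l.succ) ^ 2) +
          2 * (N : ℝ) * (((A l.succ : ℝ) / D l.succ - a l.succ) * B i l.succ +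
            a l.succ * (B i l.succ - (N : ℝ) * Z i l.succ))) := by
      have : ∑ l : Fin k, ((B i l.succ : ℝ) ^ 2 + 2 * N * (A l.succ / D l.succ) * B i l.succ) =
          ∑ l : Fin k, (((B i l.succ : ℝ) ^ 2 - ((N : ℝ) * Z i l.succ) ^ 2) +
          2 * (N : ℝ) * (((A l.succ : ℝ) / D l.succ - a l.succ) * B i l.succ +
            a l.succ * (B i l.succ - (N : ℝ) * Z i l.succ))) +
          (N : ℝ) ^ 2 * ∑ l : Fin k, (Z i l.succ ^ 2 + 2 * (Z i l.succ * a l.succ)) := by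
        rw [Finset.mul_sum, ← Finset.sum_add_distrib]
        exact Finset.sum_congr rfl fun l _ => by ring
      rw [sphereForm, this]
      linear_combination (N : ℝ) ^ 2 * h0
    have hterm : ∀ l : Fin k, |((B i l.succ : ℝ) ^ 2 - ((N : ℝ) * Z i l.succ) ^ 2) +
          2 * (N : ℝ) * (((A l.succ : ℝ) / D l.succ - a l.succ) * B i l.succ +
            a l.succ * (B i l.succ - (N : ℝ) * Z i l.succ))| ≤ 7 * (N : ℝ) := by
      intro l
      have h1 : |((A l.succ : ℝ) / D l.succ - a l.succ) * B i l.succ| ≤ 1 / 2 := by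
        rw [abs_mul]
        exact (mul_le_mul_of_nonneg_left (hBr i l.succ) (abs_nonneg _)).trans (hAa _)
      have h2 : |a l.succ * (B i l.succ - (N : ℝ) * Z i l.succ)| ≤ 1 := by
        rw [abs_mul]
        exact mul_le_one₀ (ha _) (abs_nonneg _) (hBZ _ _)
      have h3 : |2 * (N : ℝ) * (((A l.succ : ℝ) / D l.succ - a l.succ) * B i l.succ +
            a l.succ * (B i l.succ - (N : ℝ) * Z i l.succ))| ≤ 2 * N * (1 / 2 + 1) := by
        rw [abs_mul, abs_of_nonneg (by positivity : (0 : ℝ) ≤ 2 * N)]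
        gcongr
        exact (abs_add_le _ _).trans (add_le_add h1 h2)
      refine (abs_add_le _ _).trans ?_
      linarith [hsq i l.succ]
    rw [key]
    refine (abs_add_le _ _).trans ?_
    have h4 : |((B i 0 : ℝ) ^ 2 - (N * Z i 0) ^ 2) - N * (B i 0 - N * Z i 0)| ≤ 7 * (N : ℝ) := by
      refine (abs_sub _ _).trans ?_
      rw [abs_mul, Nat.abs_cast]
      nlinarith [hsq i 0, hBZ i 0]
    have h5 := (Finset.abs_sum_le_sum_abs (fun l : Fin k =>
      ((B i l.succ : ℝ) ^ 2 - (N * Z i l.succ) ^ 2) +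
          2 * N * (((A l.succ : ℝ) / D l.succ - a l.succ) * B i l.succ +
            a l.succ * (B i l.succ - N * Z i l.succ))) Finset.univ).trans
      (Finset.sum_le_sum fun l _ => hterm l)
    simp only [Finset.sum_const, Finset.card_univ, Fintype.card_fin, nsmul_eq_mul] at h5
    nlinarith

theorem IsConfusing.exists_isCode {n k N : ℕ} (hN : 1 ≤ N) {E : Type*} [NormedAddCommGroup E]
    [InnerProductSpace ℝ E] {H : Matrix (Fin n) (Fin (k + 1)) ℝ} {s : Fin (k + 1) → ℝ}
    (hs : s ∈ messages (k + 1)) {v : Fin n → ℝ} {w : Fin (k + 1) → E} {w₀ : E}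
    (h : IsConfusing H s v w w₀) {M : ℝ} (hM : ∀ r i, |H r i| ≤ M) :
    ∃ (σ : Equiv.Perm (Fin (k + 1))) (D : Fin k → ℕ) (A : Fin k → ℤ)
      (B : Matrix (Fin (k + 1)) (Fin (k + 1)) ℤ), IsCode (7 * (k + 1)) N D A B ∧
      ∀ r l, |∑ i, s (σ i) * H r (σ i) * B i l| ≤ 2 * N * √(∑ r, v r ^ 2) + (k + 1) * M := by
  obtain ⟨hw0, hw, hfit, j, hj⟩ := h
  have hss : ∀ i, s i * s i = 1 := fun i => by rcases hs i with h | h <;> simp [h]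
  have hsa : ∀ i, |s i| = 1 := fun i => by rcases hs i with h | h <;> simp [h]
  let u : Fin (k + 1) → E := fun i => s i • w i - w₀
  obtain ⟨σ, Z, a, hσ, hlow, hdom, hnorm, hG, ha, ha1⟩ :=
    exists_pivoted_triangular_coordinates (k + 1) (Fintype.card_fin _) u w₀
  let σ' : Equiv.Perm (Fin (k + 1)) := Equiv.ofBijective σ (Finite.injective_iff_bijective.1 hσ)
  have hsw : ∀ i, (inner ℝ (s i • w i) (s i • w i) : ℝ) = 1 := fun i => by
    rw [real_inner_self_eq_norm_sq, norm_smul, hw, Real.norm_eq_abs, hsa]; norm_num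
  have hw00 : (inner ℝ w₀ w₀ : ℝ) = 1 := by rw [real_inner_self_eq_norm_sq, hw0]; norm_num
  have huu : ∀ i, (inner ℝ (u i) (u i) : ℝ) + 2 * inner ℝ (u i) w₀ = 0 := fun i => by
    simp only [u, inner_sub_left, inner_sub_right, hsw, hw00, real_inner_comm (s i • w i) w₀]
    ring
  have huj : 2 ≤ ‖u j‖ ^ 2 := by
    rw [← real_inner_self_eq_norm_sq]
    have h1 := huu j
    have h2 : (inner ℝ (u j) w₀ : ℝ) = s j * inner ℝ (w j) w₀ - 1 := by
      simp [u, inner_sub_left, inner_smul_left, hw0]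
    linarith
  have hd : 1 ≤ Z 0 0 := by
    have h1 := hnorm (σ'.symm j) 0 rfl
    rw [show σ (σ'.symm j) = j from σ'.apply_symm_apply j] at h1
    nlinarith [norm_nonneg (u j)]
  have hd0 : 0 < Z 0 0 := by linarith
  obtain ⟨D, A, B, hcode, hBZ⟩ := exists_isCode_of_sphere (k := k) hN
    (fun i l => Z i l / Z 0 0) (fun l => a l / Z 0 0)
    (fun i l hil => by simp [hlow i l hil])
    (fun i l l' hl => by
      rw [abs_div, abs_of_pos hd0]; exact div_le_div_of_nonneg_right (hdom i l l' hl) hd0.le)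
    (div_self hd0.ne')
    (fun l => by
      rw [abs_div, abs_of_pos hd0, div_le_one hd0]; exact (ha1 l).trans (hw0 ▸ hd))
    (by
      have h1 := huu (σ 0)
      rw [hG, ha, Fin.sum_univ_succ, Fin.sum_univ_succ] at h1
      simp only [hlow 0 _ (Fin.succ_pos _), zero_mul, Finset.sum_const_zero, add_zero] at h1
      field_simp
      have : Z 0 0 * (Z 0 0 + 2 * a 0) = 0 := by linarith
      rcases mul_eq_zero.1 this with h | h <;> linarith)
    (fun i => by
      have h1 := huu (σ i)
      rw [hG, ha, Finset.mul_sum, ← Finset.sum_add_distrib] at h1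
      have : ∑ l, ((Z i l / Z 0 0) ^ 2 + 2 * (Z i l / Z 0 0 * (a l / Z 0 0))) =
          (∑ l, (Z i l * Z i l + 2 * (Z i l * a l))) / Z 0 0 ^ 2 := by
        rw [Finset.sum_div]
        exact Finset.sum_congr rfl fun l _ => by field_simp
      rw [this, h1, zero_div])
  refine ⟨σ', D, A, B, hcode, fun r l => ?_⟩
  set V := √(∑ r, v r ^ 2) with hV
  have hV2 : V ^ 2 = ∑ r, v r ^ 2 := Real.sq_sqrt (Finset.sum_nonneg fun _ _ => sq_nonneg _)
  have hV0 : 0 ≤ V := Real.sqrt_nonneg _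
  have hvr : |v r| ≤ V := by
    apply abs_le_of_sq_le_sq _ hV0
    rw [hV2]
    exact Finset.single_le_sum (f := fun r => v r ^ 2) (fun _ _ => sq_nonneg _) (Finset.mem_univ r)
  -- the rows of the channel nearly annihilate the vectors `u i`
  have hu : ‖∑ i, (s i * H r i) • u i‖ ≤ 2 * V := by
    have h1 : ‖∑ i, H r i • w i - (H.mulVec s + v) r • w₀‖ ≤ V := by
      apply le_of_sq_le_sq _ hV0
      rw [hV2]
      exact (Finset.single_le_sum (f := fun r => ‖∑ i, H r i • w i - (H.mulVec s + v) r • w₀‖ ^ 2)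
        (fun _ _ => sq_nonneg _) (Finset.mem_univ r)).trans hfit
    have h2 : ∑ i, (s i * H r i) • u i =
        (∑ i, H r i • w i - (H.mulVec s + v) r • w₀) + v r • w₀ := by
      have : ∀ i, (s i * H r i) • u i = H r i • w i - (H r i * s i) • w₀ := fun i => by
        simp only [u, smul_sub, smul_smul]
        rw [show s i * H r i * s i = (s i * s i) * H r i by ring, hss, one_mul, mul_comm (s i)]
      simp only [this, Finset.sum_sub_distrib, ← Finset.sum_smul, Pi.add_apply, add_smul]
      simp only [Matrix.mulVec, dotProduct]
      abel
    rw [h2]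
    refine (norm_add_le _ _).trans ?_
    rw [norm_smul, hw0, mul_one, Real.norm_eq_abs]
    linarith
  set g : Fin (k + 1) → ℝ := fun i => s (σ i) * H r (σ i) with hg
  have hgM : ∀ i, |g i| ≤ M := fun i => by
    rw [hg]; simp only [abs_mul, hsa, one_mul]; exact hM _ _
  have hsum : ∑ i, (s i * H r i) • u i = ∑ i, g i • u (σ i) :=
    (Equiv.sum_comp σ' fun i => (s i * H r i) • u i).symm
  have hZg : |∑ i, g i * Z i l| ≤ 2 * V := by
    refine abs_le_of_sq_le_sq ?_ (by positivity)
    have h1 : ‖∑ i, g i • u (σ i)‖ ^ 2 = ∑ l, (∑ i, g i * Z i l) ^ 2 := by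
      rw [← real_inner_self_eq_norm_sq, sum_inner]
      simp only [inner_sum, inner_smul_left, inner_smul_right, hG, RCLike.conj_to_real, sq,
        Finset.sum_mul, Finset.mul_sum]
      rw [Finset.sum_comm]
      conv_rhs => rw [Finset.sum_comm]
      refine Finset.sum_congr rfl fun i _ => ?_
      rw [Finset.sum_comm]
      exact Finset.sum_congr rfl fun l _ => Finset.sum_congr rfl fun j _ => by ring
    have h2 : (∑ i, g i * Z i l) ^ 2 ≤ ‖∑ i, g i • u (σ i)‖ ^ 2 := by
      rw [h1]
      exact Finset.single_le_sum (f := fun l => (∑ i, g i * Z i l) ^ 2) (fun _ _ => sq_nonneg _)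
        (Finset.mem_univ l)
    rw [hsum] at hu
    exact h2.trans (pow_le_pow_left₀ (norm_nonneg _) hu 2)
  have hsplit : ∑ i, g i * B i l = N * ((∑ i, g i * Z i l) / Z 0 0) +
      ∑ i, g i * (B i l - N * (Z i l / Z 0 0)) := by
    rw [Finset.sum_div, Finset.mul_sum, ← Finset.sum_add_distrib]
    exact Finset.sum_congr rfl fun i _ => by ring
  change |∑ i, g i * B i l| ≤ _
  rw [hsplit]
  refine (abs_add_le _ _).trans (add_le_add ?_ ?_)
  · rw [abs_mul, Nat.abs_cast, abs_div, abs_of_pos hd0]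
    have : |∑ i, g i * Z i l| / Z 0 0 ≤ 2 * V :=
      (div_le_self (abs_nonneg _) hd).trans hZg
    calc _ ≤ (N : ℝ) * (2 * V) := by gcongr
      _ = _ := by ring
  · refine (Finset.abs_sum_le_sum_abs _ _).trans ?_
    refine (Finset.sum_le_sum (g := fun _ => M) fun i _ => ?_).trans (by simp)
    rw [abs_mul]
    exact (mul_le_mul (hgM i) (hBZ i l) (abs_nonneg _) ((abs_nonneg _).trans (hgM i))).trans
      (by simp)

/-! ### Counting the codes -/

theorem card_le_of_abs_sub_le {S : Finset ℤ} {L : ℕ} (h : ∀ x ∈ S, ∀ y ∈ S, |x - y| ≤ L) :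
    S.card ≤ L + 1 := by
  rcases S.eq_empty_or_nonempty with rfl | hS
  · simp
  have hsub : S ⊆ Finset.Icc (S.min' hS) (S.min' hS + L) := by
    intro x hx
    have := (abs_le.1 (h x hx _ (S.min'_mem hS))).2
    exact Finset.mem_Icc.2 ⟨S.min'_le x hx, by linarith⟩
  refine (Finset.card_le_card hsub).trans ?_
  simp only [Int.card_Icc]
  omega

/-- Away from its double point, the sphere equation, quadratic in the first coordinate, has
boundedly many solutions. -/
theorem card_le_of_abs_sq_sub_mul_add_le {S : Finset ℤ} {C N : ℕ} {R : ℝ} (hN : 32 * C ≤ N)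
    (hN0 : 1 ≤ N) (hR : |R| ≤ (N : ℝ) ^ 2 / 8)
    (h : ∀ x ∈ S, |(x : ℝ) ^ 2 - N * x + R| ≤ C * N) : S.card ≤ 2 * (4 * C + 1) := by
  have hN' : (32 * C : ℝ) ≤ N := by exact_mod_cast hN
  have hN0' : (1 : ℝ) ≤ N := by exact_mod_cast hN0
  have hfar : ∀ x ∈ S, ((N : ℝ) / 4) ^ 2 ≤ (x - N / 2) ^ 2 := by
    intro x hx
    have h1 := (abs_le.1 (h x hx)).1
    have h2 := (abs_le.1 hR).2
    have h3 : 32 * C * (N : ℝ) ≤ N * N := by gcongr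
    nlinarith
  -- two solutions on the same side of `N / 2` are close
  have hclose : ∀ x ∈ S, ∀ y ∈ S, (N : ℝ) / 2 ≤ |(x : ℝ) + y - N| → |x - y| ≤ ((4 * C : ℕ) : ℤ) := by
    intro x hx y hy hxy
    have h1 : |(x : ℝ) - y| * |(x : ℝ) + y - N| ≤ 2 * C * N := by
      rw [← abs_mul]
      have : ((x : ℝ) - y) * (x + y - N) = (x ^ 2 - N * x + R) - (y ^ 2 - N * y + R) := by ring
      rw [this]
      exact (abs_sub _ _).trans (by linarith [h x hx, h y hy])
    have h2 : |(x : ℝ) - y| ≤ 4 * C := by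
      have h3 : |(x : ℝ) - y| * (N / 2) ≤ 2 * C * N :=
        (mul_le_mul_of_nonneg_left hxy (abs_nonneg _)).trans h1
      by_contra! hc
      nlinarith
    exact_mod_cast h2
  rw [← Finset.card_filter_add_card_filter_not (fun x : ℤ => (N : ℝ) / 2 ≤ x)]
  have hA : (S.filter (fun x : ℤ => (N : ℝ) / 2 ≤ x)).card ≤ 4 * C + 1 := by
    apply card_le_of_abs_sub_le
    intro x hx y hy
    rw [Finset.mem_filter] at hx hy
    refine hclose x hx.1 y hy.1 (le_trans ?_ (le_abs_self _))
    have h1 := abs_le_of_sq_le_sq (hfar x hx.1) (by linarith [hx.2])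
    have h2 := abs_le_of_sq_le_sq (hfar y hy.1) (by linarith [hy.2])
    rw [abs_of_nonneg (by positivity)] at h1 h2
    linarith
  have hB : (S.filter (fun x : ℤ => ¬ (N : ℝ) / 2 ≤ x)).card ≤ 4 * C + 1 := by
    apply card_le_of_abs_sub_le
    intro x hx y hy
    rw [Finset.mem_filter, not_le] at hx hy
    refine hclose x hx.1 y hy.1 (le_trans ?_ (neg_le_abs _))
    have h1 := hfar x hx.1
    have h2 := hfar y hy.1
    rw [← neg_sq ((x : ℝ) - N / 2)] at h1
    rw [← neg_sq ((y : ℝ) - N / 2)] at h2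
    have h1 := abs_le_of_sq_le_sq h1 (by linarith [hx.2])
    have h2 := abs_le_of_sq_le_sq h2 (by linarith [hy.2])
    rw [abs_of_nonneg (by positivity)] at h1 h2
    linarith
  omega

/-- The area of an annulus depends only on the difference of the squared radii. -/
theorem volume_annulus_le (c : ℂ) (T W : ℝ) (hW : 0 ≤ W) :
    volume {z : ℂ | |‖z - c‖ ^ 2 - T| ≤ W} ≤ ENNReal.ofReal (7 * W) := by
  rcases lt_or_ge (T + W) 0 with hTW | hTW
  · have : {z : ℂ | |‖z - c‖ ^ 2 - T| ≤ W} = ∅ := by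
      ext z
      simp only [Set.mem_ofPred_eq, Set.mem_empty_iff_false, iff_false]
      intro h
      nlinarith [(abs_le.1 h).2, sq_nonneg ‖z - c‖]
    rw [this, measure_empty]
    exact zero_le
  have hsub : {z : ℂ | |‖z - c‖ ^ 2 - T| ≤ W} ⊆
      Metric.closedBall c √(T + W) \ Metric.ball c √(T - W) := by
    intro z hz
    have hz : |‖z - c‖ ^ 2 - T| ≤ W := hz
    have hz := abs_le.1 hz
    constructor
    · rw [Metric.mem_closedBall, dist_eq_norm]
      exact Real.le_sqrt_of_sq_le (by linarith)
    · rw [Metric.mem_ball, dist_eq_norm, not_lt]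
      exact Real.sqrt_le_iff.2 ⟨norm_nonneg _, by linarith⟩
  refine (measure_mono hsub).trans ?_
  have hbb : Metric.ball c √(T - W) ⊆ Metric.closedBall c √(T + W) :=
    Metric.ball_subset_closedBall.trans
      (Metric.closedBall_subset_closedBall (Real.sqrt_le_sqrt (by linarith)))
  rw [measure_sdiff hbb measurableSet_ball.nullMeasurableSet measure_ball_lt_top.ne,
    Complex.volume_ball, Complex.volume_closedBall]
  have hp : ((NNReal.pi : ℝ≥0) : ENNReal) = ENNReal.ofReal Real.pi := by
    rw [ENNReal.ofReal, Real.toNNReal_of_nonneg Real.pi_pos.le]; rfl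
  rw [hp, ← ENNReal.ofReal_pow (Real.sqrt_nonneg _), ← ENNReal.ofReal_pow (Real.sqrt_nonneg _),
    ← ENNReal.ofReal_mul (by positivity), ← ENNReal.ofReal_mul (by positivity),
    ← ENNReal.ofReal_sub _ (by positivity), Real.sq_sqrt hTW]
  apply ENNReal.ofReal_le_ofReal
  have hpi := Real.pi_lt_d2
  have hpi0 := Real.pi_pos
  have : T - W ≤ √(T - W) ^ 2 := by
    rcases le_or_gt 0 (T - W) with h | h
    · rw [Real.sq_sqrt h]
    · exact h.le.trans (sq_nonneg _)
  nlinarith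

/-- An annulus contains few lattice points, because the unit squares at these points are disjoint
and lie in a slightly larger annulus. -/
theorem card_lattice_annulus_le {S : Finset (ℤ × ℤ)} {C N : ℕ} {α β T : ℝ} (hN0 : 1 ≤ N)
    (h : ∀ p ∈ S, |((p.1 : ℝ) - α) ^ 2 + (p.2 - β) ^ 2 - T| ≤ C * N)
    (hα : ∀ p ∈ S, |(p.1 : ℝ) - α| ≤ 3 * N) (hβ : ∀ p ∈ S, |(p.2 : ℝ) - β| ≤ 3 * N) :
    S.card ≤ 7 * (C + 14) * N := by
  have hN0' : (1 : ℝ) ≤ N := by exact_mod_cast hN0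
  let Q : ℤ × ℤ → Set ℂ := fun p => Set.Ico (p.1 : ℝ) (p.1 + 1) ×ℂ Set.Ico (p.2 : ℝ) (p.2 + 1)
  have hQ : ∀ p z, z ∈ Q p ↔ ⌊z.re⌋ = p.1 ∧ ⌊z.im⌋ = p.2 := by
    intro p z
    simp [Q, Complex.mem_reProdIm, Int.floor_eq_iff]
  have hQm : ∀ p, MeasurableSet (Q p) := fun p =>
    (measurableSet_Ico.preimage Complex.measurable_re).inter
      (measurableSet_Ico.preimage Complex.measurable_im)
  have hQv : ∀ p, volume (Q p) = 1 := by
    intro p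
    have h1 : Q p = Complex.measurableEquivRealProd ⁻¹'
        (Set.Ico (p.1 : ℝ) (p.1 + 1) ×ˢ Set.Ico (p.2 : ℝ) (p.2 + 1)) := by
      ext z; simp [Q, Complex.mem_reProdIm, Complex.measurableEquivRealProd_apply]
    rw [h1, Complex.volume_preserving_equiv_real_prod.measure_preimage_equiv, Measure.volume_eq_prod,
      Measure.prod_prod]
    simp
  have hsum : volume (⋃ p ∈ S, Q p) = S.card := by
    rw [measure_biUnion_finset _ fun p _ => hQm p]
    · simp [hQv]
    · intro p _ q _ hpq
      refine Set.disjoint_left.2 fun z hz hz' => hpq ?_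
      rw [hQ] at hz hz'
      exact Prod.ext (hz.1.symm.trans hz'.1) (hz.2.symm.trans hz'.2)
  have hshift : ∀ a t : ℝ, |a| ≤ 3 * N → 0 ≤ t → t ≤ 1 → |(a + t) ^ 2 - a ^ 2| ≤ 7 * N := by
    intro a t ha ht ht'
    have : (a + t) ^ 2 - a ^ 2 = t * (2 * a + t) := by ring
    rw [this, abs_mul, abs_of_nonneg ht]
    have h2 : |2 * a + t| ≤ 7 * N := by
      rw [abs_le] at ha ⊢
      constructor <;> linarith
    nlinarith [abs_nonneg (2 * a + t)]
  have hsub : (⋃ p ∈ S, Q p) ⊆ {z : ℂ | |‖z - ⟨α, β⟩‖ ^ 2 - T| ≤ (C + 14) * N} := by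
    intro z hz
    simp only [Set.mem_iUnion] at hz
    obtain ⟨p, hp, hz⟩ := hz
    simp only [Q, Complex.mem_reProdIm, Set.mem_Ico] at hz
    have h1 := hshift _ (z.re - p.1) (hα p hp) (by linarith [hz.1.1]) (by linarith [hz.1.2])
    have h2 := hshift _ (z.im - p.2) (hβ p hp) (by linarith [hz.2.1]) (by linarith [hz.2.2])
    have h3 := h p hp
    rw [show (p.1 : ℝ) - α + (z.re - p.1) = z.re - α by ring] at h1
    rw [show (p.2 : ℝ) - β + (z.im - p.2) = z.im - β by ring] at h2
    have h4 : ‖z - ⟨α, β⟩‖ ^ 2 = (z.re - α) ^ 2 + (z.im - β) ^ 2 := by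
      rw [Complex.sq_norm, Complex.normSq_apply]; simp [sq]
    simp only [Set.mem_ofPred_eq]
    rw [h4]
    rw [abs_le] at h1 h2 h3 ⊢
    constructor <;> linarith [h1.1, h1.2, h2.1, h2.2, h3.1, h3.2]
  have hfin := (measure_mono hsub).trans (volume_annulus_le ⟨α, β⟩ T ((C + 14) * N) (by positivity))
  rw [hsum, ← ENNReal.ofReal_natCast, ENNReal.ofReal_le_ofReal_iff (by positivity)] at hfin
  have : (S.card : ℝ) ≤ ((7 * (C + 14) * N : ℕ) : ℝ) := by push_cast; linarith
  exact_mod_cast this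

open Classical in
/-- The possible `i`-th rows of the matrix of a code with diagonal `D` and centre `A`. -/
noncomputable def codeRows {k : ℕ} (C N : ℕ) (D : Fin k → ℕ) (A : Fin k → ℤ) (i : Fin (k + 1)) :
    Finset (Fin (k + 1) → ℤ) :=
  (Fintype.piFinset (Fin.cons (α := fun _ => Finset ℤ) (Finset.Icc (-(N + 1 : ℤ)) (N + 1))
    fun l => Finset.Icc (-(D l : ℤ)) (D l))).filter fun b =>
      (∀ l, i < l → b l = 0) ∧ (i = 0 → b 0 = N + 1) ∧ (∀ l : Fin k, i = l.succ → b i = D l) ∧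
        (i ≠ 0 → |sphereForm N D A b| ≤ C * N)

theorem mem_codeRows {k C N : ℕ} {D : Fin k → ℕ} {A : Fin k → ℤ} {i : Fin (k + 1)}
    {b : Fin (k + 1) → ℤ} : b ∈ codeRows C N D A i ↔
      (|b 0| ≤ N + 1 ∧ ∀ l : Fin k, |b l.succ| ≤ D l) ∧
      (∀ l, i < l → b l = 0) ∧ (i = 0 → b 0 = N + 1) ∧ (∀ l : Fin k, i = l.succ → b i = D l) ∧
        (i ≠ 0 → |sphereForm N D A b| ≤ C * N) := by
  simp only [codeRows, Finset.mem_filter, Fintype.mem_piFinset, Fin.forall_fin_succ (n := k),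
    Fin.cons_zero, Fin.cons_succ, Finset.mem_Icc, abs_le]

theorem IsCode.mem_piFinset {k C N : ℕ} {D : Fin k → ℕ} {A : Fin k → ℤ}
    {B : Matrix (Fin (k + 1)) (Fin (k + 1)) ℤ} (h : IsCode C N D A B) :
    (fun i => B i) ∈ Fintype.piFinset (codeRows C N D A) := by
  rw [Fintype.mem_piFinset]
  intro i
  rw [mem_codeRows]
  exact ⟨⟨h.abs_zero i, h.abs_succ i⟩, h.lower i, fun hi => hi ▸ h.corner,
    fun l hl => hl ▸ h.diag l, h.sphere i⟩

theorem card_codeRows_zero_le {k C N : ℕ} (D : Fin k → ℕ) (A : Fin k → ℤ) :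
    (codeRows C N D A 0).card ≤ 1 := by
  refine Finset.card_le_one.2 fun b hb b' hb' => ?_
  rw [mem_codeRows] at hb hb'
  funext l
  cases l using Fin.cases with
  | zero => rw [hb.2.2.1 rfl, hb'.2.2.1 rfl]
  | succ l => rw [hb.2.1 _ (Fin.succ_pos l), hb'.2.1 _ (Fin.succ_pos l)]

/-- The product of the cardinalities `2 d + 1` of the intervals `[-d, d]`. -/
theorem prod_two_mul_add_one_le {k : ℕ} {D : Fin k → ℕ} (hD : ∀ l, 1 ≤ D l) :
    ∏ l, (2 * D l + 1) ≤ 3 ^ k * ∏ l, D l := by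
  calc ∏ l, (2 * D l + 1) ≤ ∏ l, 3 * D l :=
        Finset.prod_le_prod' fun l _ => by have := hD l; omega
    _ = 3 ^ k * ∏ l, D l := by simp [Finset.prod_mul_distrib]

theorem card_piFinset_Icc {k : ℕ} (D : Fin k → ℕ) :
    (Fintype.piFinset fun l => Finset.Icc (-(D l : ℤ)) (D l)).card = ∏ l, (2 * D l + 1) := by
  rw [Fintype.card_piFinset]
  refine Finset.prod_congr rfl fun l _ => ?_
  rw [Int.card_Icc]; omega

/-- When the diagonal is small compared with `N`, all entries but the first leave boundedly many
choices for the first. -/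
theorem card_le_of_tail_eq {k C N : ℕ} (hN : 32 * C ≤ N) (hN0 : 1 ≤ N) {D : Fin k → ℕ}
    {A : Fin k → ℤ} (hD : ∀ l, 1 ≤ D l) (hDN : ∀ l, 24 * k * D l ≤ N) (hA : ∀ l, |A l| ≤ D l)
    {i : Fin (k + 1)} (hi : i ≠ 0) {S : Finset (Fin (k + 1) → ℤ)} (hS : S ⊆ codeRows C N D A i)
    (y : Fin k → ℤ) (hy : ∀ b ∈ S, Fin.tail b = y) : S.card ≤ 2 * (4 * C + 1) := by
  rcases S.eq_empty_or_nonempty with rfl | ⟨b₀, hb₀⟩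
  · simp
  have hinj : Set.InjOn (fun b : Fin (k + 1) → ℤ => b 0) S := by
    intro b hb b' hb' h
    rw [← Fin.cons_self_tail b, ← Fin.cons_self_tail b', hy b hb, hy b' hb']
    simp only at h
    rw [h]
  rw [← Finset.card_image_of_injOn hinj]
  have hyD : ∀ l, |(y l : ℝ)| ≤ D l := by
    intro l
    have := (mem_codeRows.1 (hS hb₀)).1.2 l
    rw [← hy b₀ hb₀]
    exact_mod_cast this
  refine card_le_of_abs_sq_sub_mul_add_le (R := ∑ l, ((y l : ℝ) ^ 2 +
    2 * (N : ℝ) * (A l / D l) * y l)) hN hN0 ?_ ?_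
  · have hNr : (1 : ℝ) ≤ N := by exact_mod_cast hN0
    have hterm : ∀ l, |(y l : ℝ) ^ 2 + 2 * (N : ℝ) * (A l / D l) * y l| ≤ 3 * (N : ℝ) * D l := by
      intro l
      have hk : 1 ≤ k := Nat.one_le_iff_ne_zero.2 fun h => (h ▸ l).elim0
      have h1 : (D l : ℝ) ≤ N := by
        have := hDN l
        exact_mod_cast (show D l ≤ N by nlinarith)
      have hDl : (0 : ℝ) < D l := by exact_mod_cast hD l
      have h2 : |(A l : ℝ) / D l| ≤ 1 := by
        rw [abs_div, Nat.abs_cast, div_le_one hDl]; exact_mod_cast hA l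
      have h3 : |2 * (N : ℝ) * (A l / D l) * y l| ≤ 2 * N * 1 * D l := by
        rw [abs_mul, abs_mul, abs_of_nonneg (by positivity : (0 : ℝ) ≤ 2 * N)]
        gcongr
        exact hyD l
      have h4 : |(y l : ℝ) ^ 2| ≤ D l ^ 2 := by
        rw [abs_pow]; exact pow_le_pow_left₀ (abs_nonneg _) (hyD l) 2
      refine (abs_add_le _ _).trans ?_
      nlinarith
    have hsum : 24 * ∑ l, (D l : ℝ) ≤ N := by
      rcases Nat.eq_zero_or_pos k with rfl | hk
      · simp
      · have h5 : ∑ l, 24 * k * D l ≤ ∑ _l : Fin k, N := Finset.sum_le_sum fun l _ => hDN l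
        rw [← Finset.mul_sum] at h5
        simp only [Finset.sum_const, Finset.card_univ, Fintype.card_fin, smul_eq_mul] at h5
        have h6 : 24 * ∑ l, D l ≤ N := by
          refine Nat.le_of_mul_le_mul_left ?_ hk
          linarith
        exact_mod_cast h6
    refine (Finset.abs_sum_le_sum_abs _ _).trans ((Finset.sum_le_sum fun l _ => hterm l).trans ?_)
    rw [← Finset.mul_sum]
    nlinarith
  · intro x hx
    obtain ⟨b, hb, rfl⟩ := Finset.mem_image.1 hx
    have := (mem_codeRows.1 (hS hb)).2.2.2.2 hi
    rw [← hy b hb]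
    exact this

/-- The bound that the counting lemmas below give for the number of choices of one row. -/
def rowConst (k C : ℕ) : ℕ := 2 * (4 * C + 1) * 3 ^ k + 7 * (C + 14) * (24 * k) * 3 ^ k +
  (C + 1) * (5 * (24 * k)) * 3 ^ k

/-- A row after the second one has as many choices as its entries after the first, up to a constant:
either the first entry is determined by these, or `D 0` is of order `N` and the first two entries
are a lattice point in an annulus. -/
theorem card_codeRows_succ_succ_le {j C N : ℕ} (hN : 32 * C ≤ N) (hN0 : 1 ≤ N)
    {D : Fin (j + 1) → ℕ} {A : Fin (j + 1) → ℤ} (hD : ∀ l, 1 ≤ D l) (hDN : ∀ l, D l ≤ N + 1)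
    (hanti : ∀ l l', l ≤ l' → D l' ≤ D l) (hA : ∀ l, |A l| ≤ D l) (i : Fin j) :
    (codeRows C N D A i.succ.succ).card ≤ rowConst (j + 1) C * ∏ l, D l := by
  classical
  have h3 := prod_two_mul_add_one_le hD
  rcases le_or_gt (24 * (j + 1) * D 0) N with hc | hc
  · have h1 := Finset.card_le_mul_card_image_of_maps_to (f := Fin.tail)
      (s := codeRows C N D A i.succ.succ)
      (t := Fintype.piFinset fun l => Finset.Icc (-(D l : ℤ)) (D l))
      (fun b hb => by
        rw [Fintype.mem_piFinset]
        exact fun l => Finset.mem_Icc.2 (abs_le.1 ((mem_codeRows.1 hb).1.2 l)))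
      (2 * (4 * C + 1)) (fun y _ => card_le_of_tail_eq hN hN0 hD
        (fun l => (Nat.mul_le_mul_left _ (hanti 0 l (Fin.zero_le l))).trans hc) hA
        (Fin.succ_ne_zero _) (Finset.filter_subset _ _) y
        (fun b hb => (Finset.mem_filter.1 hb).2))
    rw [card_piFinset_Icc] at h1
    refine (h1.trans (Nat.mul_le_mul_left _ h3)).trans ?_
    rw [← mul_assoc]
    refine Nat.mul_le_mul_right _ ?_
    unfold rowConst
    omega
  · have hNr : (1 : ℝ) ≤ N := by exact_mod_cast hN0
    have h1 := Finset.card_le_mul_card_image_of_maps_to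
      (f := fun b : Fin (j + 2) → ℤ => Fin.tail (Fin.tail b))
      (s := codeRows C N D A i.succ.succ)
      (t := Fintype.piFinset fun l : Fin j => Finset.Icc (-(D l.succ : ℤ)) (D l.succ))
      (fun b hb => by
        rw [Fintype.mem_piFinset]
        exact fun l => Finset.mem_Icc.2 (abs_le.1 ((mem_codeRows.1 hb).1.2 l.succ)))
      (7 * (C + 14) * N) (fun y _ => by
        have hinj : Set.InjOn (fun b : Fin (j + 2) → ℤ => (b 0, b 1))
            ((codeRows C N D A i.succ.succ).filter fun b => Fin.tail (Fin.tail b) = y) := by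
          intro b hb b' hb' h
          have hy := (Finset.mem_filter.1 hb).2
          have hy' := (Finset.mem_filter.1 hb').2
          simp only [Prod.mk.injEq] at h
          rw [← Fin.cons_self_tail b, ← Fin.cons_self_tail b', ← Fin.cons_self_tail (Fin.tail b),
            ← Fin.cons_self_tail (Fin.tail b'), hy, hy', h.1]
          congr 2
          exact h.2
        rw [← Finset.card_image_of_injOn hinj]
        have hAD : |(A 0 : ℝ) / D 0| ≤ 1 := by
          have hDl : (0 : ℝ) < D 0 := by exact_mod_cast hD 0
          rw [abs_div, Nat.abs_cast, div_le_one hDl]; exact_mod_cast hA 0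
        refine card_lattice_annulus_le (α := N / 2) (β := -(N * (A 0 / D 0)))
          (T := (N / 2 : ℝ) ^ 2 + (N * (A 0 / D 0) : ℝ) ^ 2 - ∑ l : Fin j, ((y l : ℝ) ^ 2 +
            2 * (N : ℝ) * (A l.succ / D l.succ) * y l)) hN0 ?_ ?_ ?_
        · intro p hp
          obtain ⟨b, hb, rfl⟩ := Finset.mem_image.1 hp
          have hy := (Finset.mem_filter.1 hb).2
          have h2 := (mem_codeRows.1 (Finset.mem_filter.1 hb).1).2.2.2.2 (Fin.succ_ne_zero _)
          rw [sphereForm, Fin.sum_univ_succ] at h2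
          rw [← hy]
          convert h2 using 2
          simp only [Fin.tail, Fin.succ_zero_eq_one]
          ring
        · intro p hp
          obtain ⟨b, hb, rfl⟩ := Finset.mem_image.1 hp
          have h2 := (mem_codeRows.1 (Finset.mem_filter.1 hb).1).1.1
          have h4 : |(b 0 : ℝ)| ≤ N + 1 := by exact_mod_cast h2
          rw [abs_le] at h4 ⊢
          constructor <;> linarith
        · intro p hp
          obtain ⟨b, hb, rfl⟩ := Finset.mem_image.1 hp
          have h2 := ((mem_codeRows.1 (Finset.mem_filter.1 hb).1).1.2 0).trans
            (Int.ofNat_le.2 (hDN 0))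
          have h4 : |(b 1 : ℝ)| ≤ N + 1 := by exact_mod_cast h2
          have h5 : |(N * (A 0 / D 0) : ℝ)| ≤ N := by
            rw [abs_mul, Nat.abs_cast]
            exact mul_le_of_le_one_right (by positivity) hAD
          rw [abs_le] at h4 h5 ⊢
          constructor <;> linarith)
    rw [card_piFinset_Icc (fun l : Fin j => D l.succ)] at h1
    have h4 := prod_two_mul_add_one_le (D := fun l : Fin j => D l.succ) (fun l => hD _)
    rw [Fin.prod_univ_succ (fun l => D l)]
    calc _ ≤ 7 * (C + 14) * N * (3 ^ j * ∏ l : Fin j, D l.succ) :=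
          h1.trans (Nat.mul_le_mul_left _ h4)
      _ ≤ 7 * (C + 14) * (24 * (j + 1) * D 0) * (3 ^ (j + 1) * ∏ l : Fin j, D l.succ) := by
          gcongr
          · norm_num
          · omega
      _ = 7 * (C + 14) * (24 * (j + 1)) * 3 ^ (j + 1) * (D 0 * ∏ l : Fin j, D l.succ) := by ring
      _ ≤ _ := by
          refine Nat.mul_le_mul_right _ ?_
          unfold rowConst
          omega

/-- The second row and the centre together have as many choices as the centre alone: either the
first entry of the row is determined by the centre, or `D 0` is of order `N` and the row determines
the first coordinate of the centre. -/
theorem sum_card_codeRows_one_le {j C N : ℕ} (hN : 32 * C ≤ N) (hN0 : 1 ≤ N)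
    {D : Fin (j + 1) → ℕ} (hD : ∀ l, 1 ≤ D l)
    (hanti : ∀ l l', l ≤ l' → D l' ≤ D l) :
    ∑ A ∈ Fintype.piFinset fun l => Finset.Icc (-(D l : ℤ)) (D l), (codeRows C N D A 1).card ≤
      rowConst (j + 1) C * ∏ l, D l := by
  classical
  have h3 := prod_two_mul_add_one_le hD
  have htail : ∀ (A : Fin (j + 1) → ℤ) b, b ∈ codeRows C N D A 1 →
      Fin.tail b = Fin.cons (D 0 : ℤ) (fun _ => 0) := by
    intro A b hb
    rw [mem_codeRows] at hb
    funext l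
    cases l using Fin.cases with
    | zero => exact hb.2.2.2.1 0 rfl
    | succ l => exact hb.2.1 _ (Fin.succ_lt_succ_iff.2 (Fin.succ_pos l))
  rcases le_or_gt (24 * (j + 1) * D 0) N with hc | hc
  · have h1 : ∀ A ∈ Fintype.piFinset fun l => Finset.Icc (-(D l : ℤ)) (D l),
        (codeRows C N D A 1).card ≤ 2 * (4 * C + 1) := by
      intro A hA
      rw [Fintype.mem_piFinset] at hA
      exact card_le_of_tail_eq hN hN0 hD
        (fun l => (Nat.mul_le_mul_left _ (hanti 0 l (Fin.zero_le l))).trans hc)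
        (fun l => abs_le.2 (Finset.mem_Icc.1 (hA l))) one_ne_zero subset_rfl _ (htail A)
    refine (Finset.sum_le_card_nsmul _ _ _ h1).trans ?_
    rw [card_piFinset_Icc, smul_eq_mul, mul_comm]
    refine (Nat.mul_le_mul_left _ h3).trans ?_
    rw [← mul_assoc]
    refine Nat.mul_le_mul_right _ ?_
    unfold rowConst
    omega
  · have hNr : (0 : ℝ) < N := by exact_mod_cast hN0
    rw [← Finset.card_sigma]
    have h1 := Finset.card_le_mul_card_image_of_maps_to
      (f := fun q : (_ : Fin (j + 1) → ℤ) × (Fin (j + 2) → ℤ) => (q.2 0, Fin.tail q.1))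
      (s := (Fintype.piFinset fun l => Finset.Icc (-(D l : ℤ)) (D l)).sigma
        fun A => codeRows C N D A 1)
      (t := Finset.Icc (-(N + 1 : ℤ)) (N + 1) ×ˢ
        Fintype.piFinset fun l : Fin j => Finset.Icc (-(D l.succ : ℤ)) (D l.succ))
      (fun q hq => by
        rw [Finset.mem_sigma, Fintype.mem_piFinset] at hq
        rw [Finset.mem_product, Fintype.mem_piFinset]
        exact ⟨Finset.mem_Icc.2 (abs_le.1 (mem_codeRows.1 hq.2).1.1), fun l => hq.1 l.succ⟩)
      (C + 1) (fun y _ => by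
        have hinj : Set.InjOn (fun q : (_ : Fin (j + 1) → ℤ) × (Fin (j + 2) → ℤ) => q.1 0)
            (((Fintype.piFinset fun l => Finset.Icc (-(D l : ℤ)) (D l)).sigma
              fun A => codeRows C N D A 1).filter fun q => (q.2 0, Fin.tail q.1) = y) := by
          rintro ⟨A, b⟩ hq ⟨A', b'⟩ hq' h
          obtain ⟨hq1, rfl⟩ := Finset.mem_filter.1 hq
          obtain ⟨hq1', hy⟩ := Finset.mem_filter.1 hq'
          simp only [Prod.mk.injEq] at h hy
          have hb := htail _ _ (Finset.mem_sigma.1 hq1).2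
          have hb' := htail _ _ (Finset.mem_sigma.1 hq1').2
          simp only at hb hb'
          have e1 : A = A' := by
            rw [← Fin.cons_self_tail A, ← Fin.cons_self_tail A', h, hy.2]
          have e2 : b = b' := by
            rw [← Fin.cons_self_tail b, ← Fin.cons_self_tail b', hb, hb', hy.1]
          rw [e1, e2]
        rw [← Finset.card_image_of_injOn hinj]
        have hform : ∀ a : ℤ, a ∈ (((Fintype.piFinset fun l => Finset.Icc (-(D l : ℤ)) (D l)).sigma
              fun A => codeRows C N D A 1).filter fun q => (q.2 0, Fin.tail q.1) = y).image
              (fun q => q.1 0) →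
            |(y.1 : ℝ) ^ 2 - N * y.1 + (D 0 : ℝ) ^ 2 + 2 * N * a| ≤ (C : ℝ) * N := by
          intro a ha
          obtain ⟨⟨A, b⟩, hq, rfl⟩ := Finset.mem_image.1 ha
          obtain ⟨hq1, rfl⟩ := Finset.mem_filter.1 hq
          have hq2 := (Finset.mem_sigma.1 hq1).2
          have hb := htail _ _ hq2
          have h2 := (mem_codeRows.1 hq2).2.2.2.2 one_ne_zero
          simp only at hb h2 ⊢
          rw [sphereForm] at h2
          have h4 : ∀ l : Fin (j + 1), b l.succ = (Fin.cons (D 0 : ℤ) (fun _ => 0) :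
            Fin (j + 1) → ℤ) l := fun l => congrFun hb l
          simp only [h4, Fin.sum_univ_succ, Fin.cons_zero, Fin.cons_succ] at h2
          have hDl : (D 0 : ℝ) ≠ 0 := by
            have := hD 0
            positivity
          convert h2 using 2
          simp only [Int.cast_zero, Int.cast_natCast]
          field_simp
          simp
          ring
        apply card_le_of_abs_sub_le
        intro a ha a' ha'
        have h5 := hform a ha
        have h6 := hform a' ha'
        have h7 : |(a : ℝ) - a'| ≤ (C : ℝ) := by
          rw [abs_le] at h5 h6 ⊢
          constructor <;> nlinarith
        exact_mod_cast h7)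
    rw [Finset.card_product, card_piFinset_Icc (fun l : Fin j => D l.succ), Int.card_Icc] at h1
    have h4 := prod_two_mul_add_one_le (D := fun l : Fin j => D l.succ) (fun l => hD _)
    have h8 : ((N + 1 : ℤ) + 1 - -(N + 1 : ℤ)).toNat ≤ 5 * N := by omega
    rw [Fin.prod_univ_succ (fun l => D l)]
    calc _ ≤ (C + 1) * ((5 * N) * (3 ^ j * ∏ l : Fin j, D l.succ)) :=
          h1.trans (Nat.mul_le_mul_left _ (Nat.mul_le_mul h8 h4))
      _ ≤ (C + 1) * ((5 * (24 * (j + 1) * D 0)) * (3 ^ (j + 1) * ∏ l : Fin j, D l.succ)) := by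
          gcongr
          · norm_num
          · omega
      _ = (C + 1) * (5 * (24 * (j + 1))) * 3 ^ (j + 1) * (D 0 * ∏ l : Fin j, D l.succ) := by ring
      _ ≤ _ := by
          refine Nat.mul_le_mul_right _ ?_
          unfold rowConst
          omega

/-- The codes with a given diagonal `D` number at most a constant times `(∏ D) ^ k`. -/
theorem sum_card_piFinset_codeRows_le {k C N : ℕ} (hN : 32 * C ≤ N) (hN0 : 1 ≤ N)
    {D : Fin k → ℕ} (hD : ∀ l, 1 ≤ D l) (hDN : ∀ l, D l ≤ N + 1)
    (hanti : ∀ l l', l ≤ l' → D l' ≤ D l) :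
    ∑ A ∈ Fintype.piFinset fun l => Finset.Icc (-(D l : ℤ)) (D l),
      (Fintype.piFinset (codeRows C N D A)).card ≤ (rowConst k C * ∏ l, D l) ^ k := by
  cases k with
  | zero =>
    have h0 := fun A => card_codeRows_zero_le (C := C) (N := N) D A
    simp only [Fintype.card_piFinset, Fin.prod_univ_succ, Finset.univ_eq_empty, Finset.prod_empty,
      mul_one, pow_zero]
    refine (Finset.sum_le_card_nsmul _ _ 1 fun A _ => h0 A).trans ?_
    simp
  | succ j =>
    simp only [Fintype.card_piFinset]
    rw [pow_succ', ← smul_eq_mul (a := rowConst (j + 1) C * ∏ l, D l)]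
    calc _ ≤ ∑ A ∈ Fintype.piFinset fun l => Finset.Icc (-(D l : ℤ)) (D l),
          (codeRows C N D A 1).card * (rowConst (j + 1) C * ∏ l, D l) ^ j := by
          refine Finset.sum_le_sum fun A hA => ?_
          rw [Fintype.mem_piFinset] at hA
          rw [Fin.prod_univ_succ, Fin.prod_univ_succ]
          refine (Nat.mul_le_mul (card_codeRows_zero_le D A) (Nat.mul_le_mul_left _
            (Finset.prod_le_pow_card _ _ _ fun i _ => card_codeRows_succ_succ_le hN hN0 hD hDN
              hanti (fun l => abs_le.2 (Finset.mem_Icc.1 (hA l))) i))).trans_eq ?_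
          simp
      _ ≤ _ := by
          rw [← Finset.sum_mul]
          exact Nat.mul_le_mul_right _ (sum_card_codeRows_one_le hN hN0 hD hanti)

open Classical in
/-- The possible diagonals of a code. -/
noncomputable def codeDiagonals (k N : ℕ) : Finset (Fin k → ℕ) :=
  (Fintype.piFinset fun _ => Finset.Icc 1 (N + 1)).filter fun D => ∀ l l', l ≤ l' → D l' ≤ D l

/-- The codes, weighted by the probability that the channel nearly annihilates them, sum to a power
of a harmonic sum. This is where `k + 1 ≤ n` enters. -/
theorem sum_codes_inv_pow_le {n k C N : ℕ} (hn : k + 1 ≤ n) (hN : 32 * C ≤ N) (hN0 : 1 ≤ N) :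
    ∑ D ∈ codeDiagonals k N, ∑ A ∈ Fintype.piFinset fun l => Finset.Icc (-(D l : ℤ)) (D l),
      ∑ _B ∈ Fintype.piFinset (codeRows C N D A), ((∏ l, (D l : ℝ)) ^ n)⁻¹ ≤
      rowConst k C ^ k * (1 + Real.log (N + 1 : ℕ)) ^ k := by
  calc _ ≤ ∑ D ∈ Fintype.piFinset fun _ : Fin k => Finset.Icc 1 (N + 1),
        (rowConst k C : ℝ) ^ k * ∏ l, ((D l : ℝ))⁻¹ := by
        refine (Finset.sum_le_sum (g := fun D : Fin k → ℕ =>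
          (rowConst k C : ℝ) ^ k * ∏ l, ((D l : ℝ))⁻¹) fun D hD => ?_).trans
          (Finset.sum_le_sum_of_subset_of_nonneg (Finset.filter_subset _ _)
            fun _ _ _ => by positivity)
        rw [codeDiagonals, Finset.mem_filter, Fintype.mem_piFinset] at hD
        have h1 := fun l => (Finset.mem_Icc.1 (hD.1 l)).1
        have h2 := sum_card_piFinset_codeRows_le hN hN0 h1
          (fun l => (Finset.mem_Icc.1 (hD.1 l)).2) hD.2
        have h3 : (∑ A ∈ Fintype.piFinset fun l => Finset.Icc (-(D l : ℤ)) (D l),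
          ((Fintype.piFinset (codeRows C N D A)).card : ℝ)) ≤
            ((rowConst k C : ℝ) * ∏ l, (D l : ℝ)) ^ k := by exact_mod_cast h2
        have hP : 1 ≤ ∏ l, (D l : ℝ) := by
          have : 1 ≤ ∏ l, D l := Finset.one_le_prod' fun l _ => h1 l
          exact_mod_cast this
        simp only [Finset.sum_const, nsmul_eq_mul, ← Finset.sum_mul]
        rw [← div_eq_mul_inv, div_le_iff₀ (by positivity), Finset.prod_inv_distrib]
        refine h3.trans ?_
        rw [mul_pow, mul_assoc]
        gcongr
        rw [inv_mul_eq_div, le_div_iff₀ (by positivity), ← pow_succ]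
        exact pow_le_pow_right₀ hP hn
    _ = rowConst k C ^ k * (∑ d ∈ Finset.Icc 1 (N + 1), (d : ℝ)⁻¹) ^ k := by
        rw [← Finset.mul_sum, ← Finset.prod_univ_sum (fun _ : Fin k => Finset.Icc 1 (N + 1))
          (fun _ d => (d : ℝ)⁻¹)]
        simp
    _ ≤ _ := by
        have h := harmonic_le_one_add_log (N + 1)
        rw [harmonic_eq_sum_Icc] at h
        push_cast at h ⊢
        gcongr

/-! ### Gaussian estimates -/

theorem MeasureTheory.Measure.pi_mono_measure {ι : Type*} [Fintype ι] {α : ι → Type*}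
    [∀ i, MeasurableSpace (α i)] {μ ν : ∀ i, Measure (α i)} [∀ i, SigmaFinite (μ i)]
    (h : ∀ i, μ i ≤ ν i) : Measure.pi μ ≤ Measure.pi ν := by
  have h1 : (Measure.pi μ).toOuterMeasure ≤ OuterMeasure.pi fun i => (ν i).toOuterMeasure := by
    rw [OuterMeasure.le_pi]
    intro s _
    change Measure.pi μ (Set.pi Set.univ s) ≤ _
    rw [Measure.pi_pi]
    exact Finset.prod_le_prod' fun i _ => h i (s i)
  refine Measure.le_iff.2 fun s hs => ?_
  refine (h1 s).trans ?_
  rw [Measure.pi]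
  exact le_toMeasure_apply _ _ _

theorem MeasureTheory.Measure.pi_const_smul {ι : Type*} [Fintype ι] {α : ι → Type*}
    [∀ i, MeasurableSpace (α i)] (μ : ∀ i, Measure (α i)) [∀ i, SigmaFinite (μ i)] {c : ENNReal}
    (hc : c ≠ ⊤) : Measure.pi (fun i => c • μ i) = c ^ Fintype.card ι • Measure.pi μ := by
  have : ∀ i, SigmaFinite (c • μ i) := fun i => by
    lift c to ℝ≥0 using hc
    exact SMul.sigmaFinite c
  refine Measure.pi_eq fun s _ => ?_
  simp [Measure.pi_pi, Finset.prod_mul_distrib]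

theorem gaussianReal_le_smul_volume {v : ℝ≥0} (hv : v ≠ 0) :
    gaussianReal 0 v ≤ ENNReal.ofReal (√(2 * Real.pi * v))⁻¹ • volume := by
  rw [gaussianReal_of_var_ne_zero _ hv, ← withDensity_const]
  refine withDensity_mono (ae_of_all _ fun x => ENNReal.ofReal_le_ofReal ?_)
  rw [gaussianPDFReal]
  refine mul_le_of_le_one_right (by positivity) (Real.exp_le_one_iff.2 ?_)
  rw [neg_div]
  exact neg_nonpos.2 (by positivity)

theorem smul_restrict_le_gaussianReal {v : ℝ≥0} (hv : v ≠ 0) {b : ℝ} :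
    ENNReal.ofReal (gaussianPDFReal 0 v b) • volume.restrict (Set.Icc (-b) b) ≤
      gaussianReal 0 v := by
  refine le_trans ?_ (Measure.restrict_le_self (s := Set.Icc (-b) b))
  rw [gaussianReal_of_var_ne_zero _ hv, restrict_withDensity measurableSet_Icc, ← withDensity_const]
  refine withDensity_mono ?_
  filter_upwards [ae_restrict_mem measurableSet_Icc] with x hx
  refine ENNReal.ofReal_le_ofReal ?_
  simp only [gaussianPDFReal, sub_zero]
  have : x ^ 2 ≤ b ^ 2 := sq_le_sq' hx.1 hx.2
  gcongr

theorem gaussianReal_abs_gt_le {v : ℝ≥0} (hv : v ≠ 0) {t : ℝ} (ht : 0 ≤ t) :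
    (gaussianReal 0 v).real {x | t < |x|} ≤ 2 * Real.exp (-t ^ 2 / (2 * v)) := by
  have hv0 : (0 : ℝ) < v := by exact_mod_cast pos_iff_ne_zero.2 hv
  have hexp : Real.exp (-(t / v) * t) * Real.exp (v * (t / v) ^ 2 / 2) =
      Real.exp (-t ^ 2 / (2 * v)) := by
    rw [← Real.exp_add]
    congr 1
    field_simp
    ring
  have h1 := measure_ge_le_exp_mul_mgf (μ := gaussianReal 0 v) (X := fun x => x) t
    (div_nonneg ht hv0.le) (integrable_exp_mul_gaussianReal _)
  have h2 := measure_le_le_exp_mul_mgf (μ := gaussianReal 0 v) (X := fun x => x) (-t) (t := -(t / v))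
    (neg_nonpos.2 (div_nonneg ht hv0.le)) (integrable_exp_mul_gaussianReal _)
  rw [mgf_fun_id_gaussianReal] at h1 h2
  simp only [zero_mul, zero_add] at h1 h2
  rw [hexp] at h1
  rw [show -(-(t / v)) * -t = -(t / v) * t by ring, neg_sq, hexp] at h2
  have hsub : {x : ℝ | t < |x|} ⊆ {x | t ≤ x} ∪ {x | x ≤ -t} := by
    intro x (hx : t < |x|)
    rcases lt_abs.1 hx with h | h
    · exact Or.inl h.le
    · exact Or.inr (show x ≤ -t by linarith)
  refine (measureReal_mono hsub).trans ((measureReal_union_le _ _).trans ?_)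
  linarith

instance (n m : ℕ) (v : ℝ≥0) : IsProbabilityMeasure (channelLaw n m v) := by
  unfold channelLaw; infer_instance

instance (n : ℕ) (ρ : ℝ) : IsProbabilityMeasure (noiseLaw n ρ) := by
  unfold noiseLaw; infer_instance

theorem noiseLaw_exists_abs_gt_le (n : ℕ) {ρ t : ℝ} (hρ : 0 < ρ) (ht : 0 ≤ t) :
    (noiseLaw n ρ).real {w | ∃ r, t < |w r|} ≤ n * (2 * Real.exp (-(ρ * t ^ 2) / 2)) := by
  have hsub : {w : Fin n → ℝ | ∃ r, t < |w r|} = ⋃ r, {w | t < |w r|} := by ext; simp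
  rw [hsub]
  refine (measureReal_iUnion_fintype_le _).trans ?_
  refine (Finset.sum_le_sum (g := fun _ => 2 * Real.exp (-(ρ * t ^ 2) / 2)) fun r _ => ?_).trans
    (by simp)
  have h1 := (measurePreserving_eval (fun _ : Fin n => gaussianReal 0 (Real.toNNReal ρ⁻¹))
    r).measureReal_preimage (s := {x | t < |x|})
    (measurableSet_lt measurable_const measurable_id.abs).nullMeasurableSet
  rw [noiseLaw]
  refine h1.le.trans ((gaussianReal_abs_gt_le (by simpa using hρ) ht).trans_eq ?_)
  rw [Real.coe_toNNReal _ (by positivity)]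
  congr 2
  field_simp

theorem channelLaw_exists_abs_gt_le (n m : ℕ) {v : ℝ≥0} (hv : v ≠ 0) {t : ℝ} (ht : 0 ≤ t) :
    (channelLaw n m v).real {H | ∃ r i, t < |H r i|} ≤
      n * (m * (2 * Real.exp (-t ^ 2 / (2 * v)))) := by
  have hsub : {H : Fin n → Fin m → ℝ | ∃ r i, t < |H r i|} =
      ⋃ r, ⋃ i, {H | t < |H r i|} := by ext; simp
  rw [hsub]
  refine (measureReal_iUnion_fintype_le _).trans ?_
  refine (Finset.sum_le_sum (g := fun _ => m * (2 * Real.exp (-t ^ 2 / (2 * v))))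
    fun r _ => ?_).trans (by simp)
  refine (measureReal_iUnion_fintype_le _).trans ?_
  refine (Finset.sum_le_sum (g := fun _ => 2 * Real.exp (-t ^ 2 / (2 * v)))
    fun i _ => ?_).trans (by simp)
  have h1 := ((measurePreserving_eval (fun _ : Fin m => gaussianReal 0 v) i).comp
    (measurePreserving_eval (fun _ : Fin n => Measure.pi fun _ : Fin m => gaussianReal 0 v)
      r)).measureReal_preimage (s := {x | t < |x|})
    (measurableSet_lt measurable_const measurable_id.abs).nullMeasurableSet
  rw [channelLaw]
  exact h1.le.trans (gaussianReal_abs_gt_le hv ht)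

/-- A Gaussian vector lies in a parallelepiped with probability at most a constant times its
volume. -/
theorem pi_gaussianReal_abs_mulVec_le {m : ℕ} {v : ℝ≥0} (hv : v ≠ 0)
    (G : Matrix (Fin m) (Fin m) ℝ) (hG : G.det ≠ 0) {τ : ℝ} (hτ : 0 ≤ τ) :
    (Measure.pi fun _ : Fin m => gaussianReal 0 v).real {h | ∀ l, |G.mulVec h l| ≤ τ} ≤
      ((√(2 * Real.pi * v))⁻¹ * (2 * τ)) ^ m * |G.det|⁻¹ := by
  have h1 := Measure.pi_mono_measure (ι := Fin m) fun _ => gaussianReal_le_smul_volume hv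
  rw [Measure.pi_const_smul _ ENNReal.ofReal_ne_top, Fintype.card_fin, ← volume_pi] at h1
  have hset : {h : Fin m → ℝ | ∀ l, |G.mulVec h l| ≤ τ} =
      Matrix.toLin' G ⁻¹' Set.pi Set.univ fun _ => Set.Icc (-τ) τ := by
    ext h
    simp only [Set.mem_ofPred_eq, Set.mem_preimage, Set.mem_univ_pi, Set.mem_Icc, abs_le,
      Matrix.toLin'_apply]
  have hdet : LinearMap.det (Matrix.toLin' G) = G.det := LinearMap.det_toLin' G
  have h2 := h1 {h | ∀ l, |G.mulVec h l| ≤ τ}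
  rw [Measure.smul_apply] at h2
  nth_rewrite 2 [hset] at h2
  rw [Measure.addHaar_preimage_linearMap _ (by rwa [hdet]), hdet, volume_pi_pi] at h2
  simp only [Real.volume_Icc, sub_neg_eq_add, ← two_mul] at h2
  refine ENNReal.toReal_le_of_le_ofReal (by positivity) (h2.trans_eq ?_)
  simp only [Finset.prod_const, Finset.card_univ, Fintype.card_fin, smul_eq_mul]
  rw [← ENNReal.ofReal_pow (by positivity), ← ENNReal.ofReal_pow (by linarith),
    ← ENNReal.ofReal_mul (by positivity), ← ENNReal.ofReal_mul (by positivity), abs_inv,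
    mul_pow]
  congr 1
  ring

/-- The probability that the channel, with signs `s` and column order `σ`, nearly annihilates the
matrix of a code. -/
theorem channelLaw_abs_sum_le {n k N : ℕ} {v : ℝ≥0} (hv : v ≠ 0) {s : Fin (k + 1) → ℝ}
    (hs : s ∈ messages (k + 1)) (σ : Equiv.Perm (Fin (k + 1))) {D : Fin k → ℕ}
    (hD : ∀ l, 1 ≤ D l) {B : Matrix (Fin (k + 1)) (Fin (k + 1)) ℤ}
    (hlow : ∀ i l, i < l → B i l = 0) (hcorner : B 0 0 = N + 1)
    (hdiag : ∀ l : Fin k, B l.succ l.succ = D l) {τ : ℝ} (hτ : 0 ≤ τ) :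
    (channelLaw n (k + 1) v).real
        {H | ∀ r l, |∑ i, s (σ i) * H r (σ i) * B i l| ≤ τ} ≤
      (((√(2 * Real.pi * v))⁻¹ * (2 * τ)) ^ (k + 1)) ^ n *
        (((N + 1 : ℕ) : ℝ) ^ n)⁻¹ * ((∏ l, (D l : ℝ)) ^ n)⁻¹ := by
  let G : Matrix (Fin (k + 1)) (Fin (k + 1)) ℝ :=
    (((B.map (Int.cast : ℤ → ℝ)).transpose).submatrix id σ.symm) * Matrix.diagonal s
  have hdetB : (B.map (Int.cast : ℤ → ℝ)).det = (N + 1 : ℕ) * ∏ l, (D l : ℝ) := by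
    rw [Matrix.det_of_isLowerTriangular _ fun i j hij => by
      simp [hlow i j (by simpa using hij)], Fin.prod_univ_succ]
    simp [hcorner, hdiag]
  have hdetG : |G.det| = (N + 1 : ℕ) * ∏ l, (D l : ℝ) := by
    rw [Matrix.det_mul, Matrix.det_permute', Matrix.det_transpose, Matrix.det_diagonal, abs_mul,
      abs_mul, Finset.abs_prod, hdetB]
    have h1 : ∀ i, |s i| = 1 := fun i => by rcases hs i with h | h <;> simp [h]
    have h2 : |((Equiv.Perm.sign σ.symm : ℤ) : ℝ)| = 1 := by
      rcases Int.units_eq_one_or (Equiv.Perm.sign σ.symm) with h | h <;> rw [h] <;> simp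
    rw [h2]
    simp only [h1, Finset.prod_const_one, one_mul, mul_one]
    exact abs_of_nonneg (by positivity)
  have hP : (0 : ℝ) < ∏ l, (D l : ℝ) :=
    Finset.prod_pos fun l _ => by exact_mod_cast hD l
  have hset : {H : Fin n → Fin (k + 1) → ℝ | ∀ r l, |∑ i, s (σ i) * H r (σ i) * B i l| ≤ τ} =
      Set.pi Set.univ fun _ => {h | ∀ l, |G.mulVec h l| ≤ τ} := by
    ext H
    simp only [Set.mem_ofPred_eq, Set.mem_univ_pi]
    refine forall_congr' fun r => forall_congr' fun l => ?_
    have : G.mulVec (H r) l = ∑ i, s (σ i) * H r (σ i) * B i l := by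
      rw [Matrix.mulVec, dotProduct, ← Equiv.sum_comp σ]
      refine Finset.sum_congr rfl fun i _ => ?_
      simp only [G, Matrix.mul_diagonal, Matrix.submatrix_apply, Matrix.transpose_apply,
        Matrix.map_apply, Equiv.symm_apply_apply, id]
      ring
    rw [this]
  rw [hset, channelLaw, measureReal_def, Measure.pi_pi]
  simp only [Finset.prod_const, Finset.card_univ, Fintype.card_fin, ENNReal.toReal_pow]
  have hG0 : G.det ≠ 0 := abs_pos.1 (by rw [hdetG]; positivity)
  refine (pow_le_pow_left₀ ENNReal.toReal_nonneg
    (pi_gaussianReal_abs_mulVec_le hv G hG0 hτ) n).trans_eq ?_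
  rw [hdetG, mul_pow, mul_inv, mul_pow _ _ n, inv_pow, inv_pow]
  exact (mul_assoc _ _ _).symm

/-! ### The error probability as an average over the messages -/

theorem finite_messages (m : ℕ) : (messages m).Finite := by
  have h : messages m = Set.pi Set.univ fun _ => ({1, -1} : Set ℝ) := by
    ext s; simp [messages]
  rw [h]
  exact Set.Finite.pi fun _ => Set.toFinite _

theorem one_mem_messages (m : ℕ) : (fun _ => 1) ∈ messages m := fun _ => Or.inl rfl

theorem messageLaw_eq (m : ℕ) : messageLaw m =
    Measure.sum fun s : (finite_messages m).toFinset =>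
      ((finite_messages m).toFinset.card : ENNReal)⁻¹ • Measure.dirac s.1 := by
  classical
  ext t ht
  rw [messageLaw, uniformOn, cond_apply' ht, Measure.sum_fintype, Measure.finsetSum_apply]
  simp only [Measure.smul_apply, Measure.dirac_apply' _ ht, smul_eq_mul]
  rw [← Finset.mul_sum, Finset.sum_coe_sort _ (fun s => Set.indicator t (1 : (Fin m → ℝ) → ENNReal) s)]
  have h1 : (messages m : Set (Fin m → ℝ)) = ((finite_messages m).toFinset : Set (Fin m → ℝ)) := by
    simp
  have h2 : messages m ∩ t = (((finite_messages m).toFinset.filter (· ∈ t) : Finset _) :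
      Set (Fin m → ℝ)) := by
    ext x; simp
  rw [h2, Measure.count_apply_finset]
  nth_rewrite 1 [h1]
  rw [Measure.count_apply_finset]
  congr 1
  simp [Set.indicator_apply]

/-- The detector may be non-measurable, so that this is an identity between outer measures. It
holds because fixing the message is a measurable embedding. -/
theorem errorProb_eq {n m : ℕ} (v : ℝ≥0) (d : Detector n m) (ρ : ℝ) :
    errorProb v d ρ = ((finite_messages m).toFinset.card : ℝ)⁻¹ *
      ∑ s ∈ (finite_messages m).toFinset, ((channelLaw n m v).prod (noiseLaw n ρ)).real
        {p | d (Matrix.of p.1) ((Matrix.of p.1).mulVec s + p.2) ≠ s} := by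
  have hemb : ∀ s : Fin m → ℝ, MeasurableEmbedding
      (Prod.map id (Prod.mk s) : (Fin n → Fin m → ℝ) × (Fin n → ℝ) → _) := fun s =>
    MeasurableEmbedding.id.prodMap (measurableEmbedding_prodMk_left s)
  have hfin : ∀ s : (finite_messages m).toFinset,
      SFinite ((((finite_messages m).toFinset.card : ENNReal)⁻¹ •
        Measure.dirac s.1).prod (noiseLaw n ρ)) := fun s => by
    rw [Measure.prod_smul_left]
    infer_instance
  rw [errorProb, messageLaw_eq, Measure.prod_sum_left, Measure.prod_sum_right, Measure.sum_fintype,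
    measureReal_def, Measure.finsetSum_apply]
  simp only [Measure.prod_smul_left, Measure.prod_smul_right, Measure.dirac_prod,
    Measure.smul_apply]
  have hmap : ∀ s : Fin m → ℝ, (channelLaw n m v).prod ((noiseLaw n ρ).map (Prod.mk s)) =
      ((channelLaw n m v).prod (noiseLaw n ρ)).map (Prod.map id (Prod.mk s)) := fun s => by
    rw [← Measure.map_prod_map _ _ measurable_id measurable_prodMk_left, Measure.map_id]
  simp only [hmap, (hemb _).map_apply, smul_eq_mul, ← Finset.mul_sum]
  rw [ENNReal.toReal_mul, ENNReal.toReal_sum fun _ _ => measure_ne_top _ _,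
    Finset.sum_coe_sort (finite_messages m).toFinset (fun s =>
      (((channelLaw n m v).prod (noiseLaw n ρ)) (Prod.map id (Prod.mk s) ⁻¹'
        {p | d (Matrix.of p.1) ((Matrix.of p.1).mulVec p.2.1 + p.2.2) ≠ p.2.1})).toReal)]
  simp only [ENNReal.toReal_inv, ENNReal.toReal_natCast]
  rfl

/-! ### A lower bound for every detector -/

theorem smul_restrict_le_noiseLaw (n : ℕ) {ρ : ℝ} (hρ : 0 < ρ) (b : ℝ) :
    ENNReal.ofReal (gaussianPDFReal 0 (Real.toNNReal ρ⁻¹) b) ^ n •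
      volume.restrict (Set.pi Set.univ fun _ : Fin n => Set.Icc (-b) b) ≤ noiseLaw n ρ := by
  have hv : Real.toNNReal ρ⁻¹ ≠ 0 := by simpa using hρ
  have : SigmaFinite (ENNReal.ofReal (gaussianPDFReal 0 (Real.toNNReal ρ⁻¹) b) •
      (volume : Measure ℝ).restrict (Set.Icc (-b) b)) := SMul.sigmaFinite (Real.toNNReal _)
  have h := Measure.pi_mono_measure (ι := Fin n) fun _ => smul_restrict_le_gaussianReal hv (b := b)
  rw [Measure.pi_const_smul _ ENNReal.ofReal_ne_top, Fintype.card_fin, ← Measure.restrict_pi_pi] at h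
  exact h

theorem channelLaw_forall_abs_le (n k : ℕ) {v : ℝ≥0} (hv : v ≠ 0) {η : ℝ} (hη : 0 ≤ η)
    (hη1 : η ≤ 1) : (gaussianPDFReal 0 v 1 * (2 * η)) ^ n ≤
      (channelLaw n (k + 1) v).real {H | ∀ r, |H r 0| ≤ η} := by
  have hset : {H : Fin n → Fin (k + 1) → ℝ | ∀ r, |H r 0| ≤ η} =
      Set.pi Set.univ fun _ => (fun h : Fin (k + 1) → ℝ => h 0) ⁻¹' Set.Icc (-η) η := by
    ext H; simp [abs_le]
  rw [hset, channelLaw, measureReal_def, Measure.pi_pi]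
  simp only [Finset.prod_const, Finset.card_univ, Fintype.card_fin, ENNReal.toReal_pow]
  refine pow_le_pow_left₀ (mul_nonneg (gaussianPDFReal_nonneg _ _ _) (by linarith)) ?_ n
  have h1 := (measurePreserving_eval (fun _ : Fin (k + 1) => gaussianReal 0 v)
    0).measure_preimage (s := Set.Icc (-η) η) measurableSet_Icc.nullMeasurableSet
  change _ ≤ (Measure.pi _ (Function.eval 0 ⁻¹' _)).toReal
  rw [h1, ← ENNReal.ofReal_le_iff_le_toReal (measure_ne_top _ _)]
  refine le_trans ?_ (smul_restrict_le_gaussianReal hv (b := 1) (Set.Icc (-η) η))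
  rw [Measure.smul_apply, Measure.restrict_apply measurableSet_Icc,
    Set.inter_eq_left.2 (Set.Icc_subset_Icc (by linarith) hη1), Real.volume_Icc, smul_eq_mul,
    ← ENNReal.ofReal_mul (gaussianPDFReal_nonneg _ _ _)]
  exact ENNReal.ofReal_le_ofReal (by rw [sub_neg_eq_add, two_mul])

/-- Two messages that differ only in the first entry, seen from the receiver when the first column
of the channel is small: if `t` is the received vector without the contribution of this column,
then the noise is `t ∓ H e₀`, and both noise laws dominate a common measure. -/
theorem map_restrict_prod_le {n k : ℕ} (v : ℝ≥0) {ρ : ℝ} (hρ : 0 < ρ) {η ε : ℝ}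
    (hε : |ε| = 1) :
    (((channelLaw n (k + 1) v).restrict {H | ∀ r, |H r 0| ≤ η}).prod
      (ENNReal.ofReal (gaussianPDFReal 0 (Real.toNNReal ρ⁻¹) (2 * η)) ^ n •
        volume.restrict (Set.pi Set.univ fun _ : Fin n => Set.Icc (-η) η))).map
      (fun p => (p.1, fun r => p.2 r - ε * p.1 r 0)) ≤
      (channelLaw n (k + 1) v).prod (noiseLaw n ρ) := by
  have hAm : MeasurableSet {H : Fin n → Fin (k + 1) → ℝ | ∀ r, |H r 0| ≤ η} := by
    have : {H : Fin n → Fin (k + 1) → ℝ | ∀ r, |H r 0| ≤ η} = ⋂ r, {H | |H r 0| ≤ η} := by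
      ext; simp
    rw [this]
    exact MeasurableSet.iInter fun r => measurableSet_le (by fun_prop) measurable_const
  have hTm : Measurable (fun p : (Fin n → Fin (k + 1) → ℝ) × (Fin n → ℝ) =>
      (p.1, fun r => p.2 r - ε * p.1 r 0)) := by fun_prop
  refine Measure.le_iff.2 fun S hS => ?_
  rw [Measure.map_apply hTm hS, Measure.prod_apply (hTm hS), Measure.prod_apply hS]
  refine le_trans (setLIntegral_mono' hAm fun H hH => ?_) (setLIntegral_le_lintegral _ _)
  refine le_trans ?_ (smul_restrict_le_noiseLaw n hρ (2 * η) _)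
  rw [Measure.smul_apply, Measure.smul_apply,
    Measure.restrict_apply (measurable_prodMk_left (hTm hS)),
    Measure.restrict_apply (measurable_prodMk_left hS)]
  refine mul_le_mul' le_rfl ?_
  rw [← measure_preimage_add_right volume (fun r => -(ε * H r 0))
    (Prod.mk H ⁻¹' S ∩ Set.pi Set.univ fun _ => Set.Icc (-(2 * η)) (2 * η))]
  refine measure_mono fun t ht => ⟨?_, ?_⟩
  · have := ht.1
    simp only [Set.mem_preimage] at this ⊢
    convert this using 2
    funext r
    exact (sub_eq_add_neg _ _).symm
  · intro r _
    have h1 := ht.2 r trivial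
    have h2 : |ε * H r 0| ≤ η := by rw [abs_mul, hε, one_mul]; exact hH r
    rw [abs_le] at h2
    simp only [Pi.add_apply, Set.mem_Icc] at h1 ⊢
    constructor <;> linarith [h1.1, h1.2, h2.1, h2.2]

/-- A lower bound of order `ρ ^ (-n / 2)` for every detector. One factor `√ρ⁻¹ ^ n` is the
probability that the first column of the channel is short, the other compensates for the noise
density. -/
theorem le_errorProb {n k : ℕ} {v : ℝ≥0} (hv : v ≠ 0) (d : Detector n (k + 1)) {ρ : ℝ}
    (hρ : 1 ≤ ρ) : ((finite_messages (k + 1)).toFinset.card : ℝ)⁻¹ *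
      (gaussianPDFReal 0 v 1 * (2 * √(ρ⁻¹))) ^ n *
      (gaussianPDFReal 0 (Real.toNNReal ρ⁻¹) (2 * √(ρ⁻¹)) * (2 * √(ρ⁻¹))) ^ n ≤
      errorProb v d ρ := by
  classical
  have hρ0 : 0 < ρ := by linarith
  set η := √(ρ⁻¹) with hη
  have hη0 : 0 ≤ η := Real.sqrt_nonneg _
  have hη1 : η ≤ 1 := Real.sqrt_le_one.2 (inv_le_one_of_one_le₀ hρ)
  set P := (channelLaw n (k + 1) v).prod (noiseLaw n ρ)
  set c := ENNReal.ofReal (gaussianPDFReal 0 (Real.toNNReal ρ⁻¹) (2 * η)) ^ n with hc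
  set ν := ((channelLaw n (k + 1) v).restrict {H | ∀ r, |H r 0| ≤ η}).prod
      (c • volume.restrict (Set.pi Set.univ fun _ : Fin n => Set.Icc (-η) η)) with hν
  let msg : ℝ → Fin (k + 1) → ℝ := fun ε => Fin.cons ε fun _ => 1
  let E : ℝ → Set ((Fin n → Fin (k + 1) → ℝ) × (Fin n → ℝ)) := fun ε =>
    {p | d (Matrix.of p.1) ((Matrix.of p.1).mulVec (msg ε) + p.2) ≠ msg ε}
  let T : ℝ → ((Fin n → Fin (k + 1) → ℝ) × (Fin n → ℝ)) → _ := fun ε p =>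
    (p.1, fun r => p.2 r - ε * p.1 r 0)
  have hTm : ∀ ε, Measurable (T ε) := fun ε => by
    simp only [T]; fun_prop
  have hmsg : ∀ ε, ε = 1 ∨ ε = -1 → msg ε ∈ messages (k + 1) := by
    intro ε hε i
    cases i using Fin.cases with
    | zero => exact hε
    | succ i => exact Or.inl rfl
  have hE : ∀ ε, |ε| = 1 → ν (T ε ⁻¹' E ε) ≤ P (E ε) := fun ε hε =>
    (Measure.le_map_apply (hTm ε).aemeasurable _).trans (map_restrict_prod_le v hρ0 hε _)
  -- the receiver sees the same data under both messages, so it errs under one of them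
  have hcover : Set.univ ⊆ T 1 ⁻¹' E 1 ∪ T (-1) ⁻¹' E (-1) := by
    rintro ⟨H, t⟩ -
    have hy : ∀ ε, (Matrix.of H).mulVec (msg ε) + (T ε (H, t)).2 =
        fun r => ∑ i : Fin k, H r i.succ + t r := by
      intro ε
      funext r
      simp only [Pi.add_apply, Matrix.mulVec, dotProduct, Fin.sum_univ_succ, msg, T, Matrix.of_apply,
        Fin.cons_zero, Fin.cons_succ, mul_one]
      ring
    by_contra hcon
    simp only [Set.mem_union, not_or, Set.mem_preimage, E, Set.mem_ofPred_eq, not_not] at hcon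
    obtain ⟨h1, h2⟩ := hcon
    rw [hy] at h1 h2
    have h3 := congrFun (h1.symm.trans h2) 0
    simp only [msg, Fin.cons_zero] at h3
    norm_num at h3
  have hνP : ν Set.univ ≤ P (E 1) + P (E (-1)) :=
    (measure_mono hcover).trans ((measure_union_le _ _).trans
      (add_le_add (hE 1 (by simp)) (hE (-1) (by simp))))
  have hνv : ν Set.univ = channelLaw n (k + 1) v {H | ∀ r, |H r 0| ≤ η} *
      ENNReal.ofReal ((gaussianPDFReal 0 (Real.toNNReal ρ⁻¹) (2 * η) * (2 * η)) ^ n) := by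
    rw [hν, ← Set.univ_prod_univ, Measure.prod_prod, Measure.restrict_apply_univ,
      Measure.smul_apply, Measure.restrict_apply_univ, volume_pi_pi]
    simp only [Real.volume_Icc, sub_neg_eq_add, ← two_mul, Finset.prod_const, Finset.card_univ,
      Fintype.card_fin, smul_eq_mul, hc]
    rw [← mul_pow, ← ENNReal.ofReal_mul (gaussianPDFReal_nonneg _ _ _), ENNReal.ofReal_pow]
    exact mul_nonneg (gaussianPDFReal_nonneg _ _ _) (by linarith)
  have hreal : (channelLaw n (k + 1) v).real {H | ∀ r, |H r 0| ≤ η} *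
      (gaussianPDFReal 0 (Real.toNNReal ρ⁻¹) (2 * η) * (2 * η)) ^ n ≤
      P.real (E 1) + P.real (E (-1)) := by
    have h1 := ENNReal.toReal_mono (by finiteness) hνP
    rw [hνv, ENNReal.toReal_mul, ENNReal.toReal_add (by finiteness) (by finiteness),
      ENNReal.toReal_ofReal (pow_nonneg
        (mul_nonneg (gaussianPDFReal_nonneg _ _ _) (by linarith)) n)] at h1
    exact h1
  rw [errorProb_eq, mul_assoc]
  refine mul_le_mul_of_nonneg_left ?_ (by positivity)
  have hpair : ({msg 1, msg (-1)} : Finset (Fin (k + 1) → ℝ)) ⊆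
      (finite_messages (k + 1)).toFinset := by
    intro s hs
    rw [Set.Finite.mem_toFinset]
    rcases Finset.mem_insert.1 hs with rfl | hs
    · exact hmsg 1 (Or.inl rfl)
    · rw [Finset.mem_singleton.1 hs]; exact hmsg _ (Or.inr rfl)
  have hne : msg 1 ≠ msg (-1) := fun h => by
    have := congrFun h 0
    simp only [msg, Fin.cons_zero] at this
    norm_num at this
  refine le_trans ?_ (Finset.sum_le_sum_of_subset_of_nonneg hpair fun _ _ _ => measureReal_nonneg)
  rw [Finset.sum_pair hne]
  refine le_trans ?_ hreal
  refine mul_le_mul_of_nonneg_right (channelLaw_forall_abs_le n k hv hη0 hη1)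
    (pow_nonneg (mul_nonneg (gaussianPDFReal_nonneg _ _ _) (by linarith)) n)

/-! ### An upper bound for the two detectors -/

/-- Whenever the detector errs, some configuration of vectors is confusing for the transmitted
message. -/
def ErrsOnlyIfConfused {n m : ℕ} (d : Detector n m) : Prop :=
  ∀ (H : Matrix (Fin n) (Fin m) ℝ) (s : Fin m → ℝ) (w : Fin n → ℝ), s ∈ messages m →
    d H (H.mulVec s + w) ≠ s →
    ∃ (E : Type) (_ : NormedAddCommGroup E) (_ : InnerProductSpace ℝ E) (u : Fin m → E) (u₀ : E),
      IsConfusing H s w u u₀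

theorem IsMLDetector.errsOnlyIfConfused {n m : ℕ} {d : Detector n m} (hd : IsMLDetector d) :
    ErrsOnlyIfConfused d := fun _ _ _ hs h => ⟨ℝ, _, _, hd.exists_isConfusing hs h⟩

theorem IsSDRDetector.errsOnlyIfConfused {n m : ℕ} {d : Detector n m} (hd : IsSDRDetector d) :
    ErrsOnlyIfConfused d := fun _ _ _ hs h => ⟨_, _, _, hd.exists_isConfusing hs h⟩

/-- The union bound over all codes, with the level `τ = 2 N √n t + (k + 1) M`. -/
theorem ErrsOnlyIfConfused.errorProb_le {n k N : ℕ} (hkn : k + 1 ≤ n) {v : ℝ≥0} (hv : v ≠ 0)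
    {d : Detector n (k + 1)} (hd : ErrsOnlyIfConfused d) (hN : 32 * (7 * (k + 1)) ≤ N)
    {ρ M t : ℝ} (hρ : 0 < ρ) (hM : 0 ≤ M) (ht : 0 ≤ t) :
    errorProb v d ρ ≤ n * ((k + 1 : ℕ) * (2 * Real.exp (-M ^ 2 / (2 * v)))) +
      n * (2 * Real.exp (-(ρ * t ^ 2) / 2)) +
      (k + 1).factorial * ((((√(2 * Real.pi * v))⁻¹ *
        (2 * (2 * N * (√n * t) + (k + 1) * M))) ^ (k + 1)) ^ n * (((N + 1 : ℕ) : ℝ) ^ n)⁻¹ *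
        (rowConst k (7 * (k + 1)) ^ k * (1 + Real.log (N + 1 : ℕ)) ^ k)) := by
  classical
  have hN1 : 1 ≤ N := by omega
  set τ : ℝ := 2 * N * (√n * t) + (k + 1) * M with hτ
  have hτ0 : 0 ≤ τ := by positivity
  set P := (channelLaw n (k + 1) v).prod (noiseLaw n ρ) with hP
  set bound := n * ((k + 1 : ℕ) * (2 * Real.exp (-M ^ 2 / (2 * v)))) +
      n * (2 * Real.exp (-(ρ * t ^ 2) / 2)) +
      (k + 1).factorial * ((((√(2 * Real.pi * v))⁻¹ *
        (2 * τ)) ^ (k + 1)) ^ n * (((N + 1 : ℕ) : ℝ) ^ n)⁻¹ *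
        (rowConst k (7 * (k + 1)) ^ k * (1 + Real.log (N + 1 : ℕ)) ^ k)) with hbound
  have key : ∀ s ∈ (finite_messages (k + 1)).toFinset,
      P.real {p | d (Matrix.of p.1) ((Matrix.of p.1).mulVec s + p.2) ≠ s} ≤ bound := by
    intro s hs
    rw [Set.Finite.mem_toFinset] at hs
    let F : Equiv.Perm (Fin (k + 1)) → Matrix (Fin (k + 1)) (Fin (k + 1)) ℤ →
        Set (Fin n → Fin (k + 1) → ℝ) := fun σ B =>
      {H | ∀ r l, |∑ i, s (σ i) * H r (σ i) * B i l| ≤ τ}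
    let cen : (Fin k → ℕ) → Finset (Fin k → ℤ) := fun D =>
      Fintype.piFinset fun l => Finset.Icc (-(D l : ℤ)) (D l)
    let rows : (Fin k → ℕ) → (Fin k → ℤ) → Finset (Fin (k + 1) → Fin (k + 1) → ℤ) := fun D A =>
      Fintype.piFinset (codeRows (7 * (k + 1)) N D A)
    have hsub : {p : (Fin n → Fin (k + 1) → ℝ) × (Fin n → ℝ) |
          d (Matrix.of p.1) ((Matrix.of p.1).mulVec s + p.2) ≠ s} ⊆
        ({H | ∃ r i, M < |H r i|} ×ˢ Set.univ ∪ Set.univ ×ˢ {w | ∃ r, t < |w r|}) ∪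
        (⋃ σ, ⋃ D ∈ codeDiagonals k N, ⋃ A ∈ cen D, ⋃ B ∈ rows D A, F σ B) ×ˢ Set.univ := by
      rintro ⟨H, w⟩ hp
      by_cases hH : ∃ r i, M < |H r i|
      · exact Or.inl (Or.inl ⟨hH, trivial⟩)
      by_cases hw : ∃ r, t < |w r|
      · exact Or.inl (Or.inr ⟨trivial, hw⟩)
      push Not at hH hw
      obtain ⟨E, _, _, u, u₀, hconf⟩ := hd (Matrix.of H) s w hs hp
      obtain ⟨σ, D, A, B, hcode, hB⟩ := hconf.exists_isCode hN1 hs hH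
      have hcode' : IsCode ((7 * (k + 1) : ℕ) : ℝ) N D A B := by
        push_cast; exact hcode
      refine Or.inr ⟨?_, trivial⟩
      simp only [Set.mem_iUnion]
      refine ⟨σ, D, ?_, A, ?_, B, hcode'.mem_piFinset, fun r l => (hB r l).trans ?_⟩
      · rw [codeDiagonals, Finset.mem_filter, Fintype.mem_piFinset]
        exact ⟨fun l => Finset.mem_Icc.2 ⟨hcode.one_le l, hcode.le_add_one l⟩, hcode.antitone⟩
      · exact Fintype.mem_piFinset.2 fun l => Finset.mem_Icc.2 (abs_le.1 (hcode.abs_center l))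
      · have h1 : √(∑ r, w r ^ 2) ≤ √n * t := by
          rw [← Real.sqrt_sq ht, ← Real.sqrt_mul (by positivity)]
          refine Real.sqrt_le_sqrt ?_
          refine (Finset.sum_le_sum (g := fun _ => t ^ 2) fun r _ => ?_).trans (by simp)
          rw [← sq_abs]
          exact pow_le_pow_left₀ (abs_nonneg _) (hw r) 2
        rw [hτ]
        gcongr
    refine (measureReal_mono hsub).trans ((measureReal_union_le _ _).trans (add_le_add
      ((measureReal_union_le _ _).trans (add_le_add ?_ ?_)) ?_))
    · rw [hP, measureReal_prod_prod, probReal_univ, mul_one]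
      exact channelLaw_exists_abs_gt_le n (k + 1) hv hM
    · rw [hP, measureReal_prod_prod, probReal_univ, one_mul]
      exact noiseLaw_exists_abs_gt_le n hρ ht
    · rw [hP, measureReal_prod_prod, probReal_univ, mul_one]
      refine (measureReal_iUnion_fintype_le _).trans ?_
      refine (Finset.sum_le_card_nsmul _ _ _ fun σ _ => ?_).trans_eq
        (by rw [Finset.card_univ, Fintype.card_perm, Fintype.card_fin, nsmul_eq_mul])
      set q := (((√(2 * Real.pi * v))⁻¹ * (2 * τ)) ^ (k + 1)) ^ n * (((N + 1 : ℕ) : ℝ) ^ n)⁻¹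
        with hq
      have hq0 : 0 ≤ q := by positivity
      calc _ ≤ ∑ D ∈ codeDiagonals k N, ∑ A ∈ cen D, ∑ B ∈ rows D A,
            (channelLaw n (k + 1) v).real (F σ B) :=
            (measureReal_biUnion_finset_le _ _).trans (Finset.sum_le_sum fun D _ =>
              (measureReal_biUnion_finset_le _ _).trans (Finset.sum_le_sum fun A _ =>
                measureReal_biUnion_finset_le _ _))
        _ ≤ ∑ D ∈ codeDiagonals k N, ∑ A ∈ cen D, ∑ B ∈ rows D A,
            q * ((∏ l, (D l : ℝ)) ^ n)⁻¹ := by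
            refine Finset.sum_le_sum fun D hD => Finset.sum_le_sum fun A _ =>
              Finset.sum_le_sum fun B hB => ?_
            rw [codeDiagonals, Finset.mem_filter, Fintype.mem_piFinset] at hD
            have hB := fun i => mem_codeRows.1 (Fintype.mem_piFinset.1 hB i)
            exact channelLaw_abs_sum_le hv hs σ (fun l => (Finset.mem_Icc.1 (hD.1 l)).1)
              (fun i l hil => (hB i).2.1 l hil) ((hB 0).2.2.1 rfl)
              (fun l => (hB l.succ).2.2.2.1 l rfl) hτ0
        _ = q * ∑ D ∈ codeDiagonals k N, ∑ A ∈ cen D, ∑ B ∈ rows D A,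
            ((∏ l, (D l : ℝ)) ^ n)⁻¹ := by
            simp only [Finset.mul_sum]
        _ ≤ _ := mul_le_mul_of_nonneg_left (sum_codes_inv_pow_le hkn hN hN1) hq0
  rw [errorProb_eq]
  have hcard : (0 : ℝ) < (finite_messages (k + 1)).toFinset.card := by
    exact_mod_cast Finset.card_pos.2 ⟨_, (Set.Finite.mem_toFinset _).2 (one_mem_messages (k + 1))⟩
  rw [inv_mul_le_iff₀ hcard, ← nsmul_eq_mul]
  exact Finset.sum_le_card_nsmul _ _ _ key

/-! ### The limit -/

theorem tendsto_log_div_log_of_bounds {P : ℝ → ℝ} {a c K : ℝ} {p : ℕ} (hc : 0 < c)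
    (hlow : ∀ᶠ ρ in atTop, c * ρ ^ (-a) ≤ P ρ)
    (hup : ∀ᶠ ρ in atTop, P ρ ≤ K * (1 + Real.log ρ) ^ p * ρ ^ (-a)) :
    Tendsto (fun ρ => Real.log (P ρ) / Real.log ρ) atTop (𝓝 (-a)) := by
  have hL := Real.tendsto_log_atTop
  have h1 : Tendsto (fun ρ => Real.log c / Real.log ρ + -a) atTop (𝓝 (-a)) := by
    simpa using (hL.const_div_atTop (Real.log c)).add_const (-a)
  have h2 : Tendsto (fun ρ => ((p + 1 : ℕ) : ℝ) * (Real.log (Real.log ρ) / Real.log ρ) + -a)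
      atTop (𝓝 (-a)) := by
    have h3 : Tendsto (fun x : ℝ => Real.log x / x) atTop (𝓝 0) :=
      Real.isLittleO_log_id_atTop.tendsto_div_nhds_zero
    simpa using ((h3.comp hL).const_mul ((p + 1 : ℕ) : ℝ)).add_const (-a)
  refine tendsto_of_tendsto_of_tendsto_of_le_of_le' h1 h2 ?_ ?_
  · filter_upwards [hlow, eventually_gt_atTop 1] with ρ h hρ
    have hlog := Real.log_pos hρ
    have hρ0 : 0 < ρ := by linarith
    have := Real.log_le_log (by positivity) h
    rw [Real.log_mul hc.ne' (by positivity), Real.log_rpow hρ0] at this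
    rw [div_add' _ _ _ hlog.ne']
    exact div_le_div_of_nonneg_right (by linarith) hlog.le
  · filter_upwards [hlow, hup, eventually_gt_atTop 1, hL.eventually_ge_atTop 1,
      hL.eventually_ge_atTop (K * 2 ^ p)] with ρ h0 h hρ hl1 hlK
    have hlog := Real.log_pos hρ
    have hρ0 : 0 < ρ := by linarith
    have hP : 0 < P ρ := lt_of_lt_of_le (by positivity) h0
    have hle : P ρ ≤ Real.log ρ ^ (p + 1) * ρ ^ (-a) := by
      refine h.trans (mul_le_mul_of_nonneg_right ?_ (by positivity))
      have hK : 0 ≤ K := by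
        by_contra! hK
        have : K * (1 + Real.log ρ) ^ p * ρ ^ (-a) ≤ 0 :=
          mul_nonpos_of_nonpos_of_nonneg (mul_nonpos_of_nonpos_of_nonneg hK.le (by positivity))
            (by positivity)
        linarith
      calc K * (1 + Real.log ρ) ^ p ≤ K * (2 * Real.log ρ) ^ p := by
            gcongr; linarith
        _ = K * 2 ^ p * Real.log ρ ^ p := by rw [mul_pow]; ring
        _ ≤ Real.log ρ * Real.log ρ ^ p := by gcongr
        _ = _ := by ring
    have := Real.log_le_log hP hle
    rw [Real.log_mul (by positivity) (by positivity), Real.log_rpow hρ0, Real.log_pow] at this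
    rw [← mul_div_assoc, div_add' _ _ _ hlog.ne']
    exact div_le_div_of_nonneg_right (by linarith) hlog.le

theorem sqrt_inv_pow_eq_rpow {ρ : ℝ} (hρ : 0 < ρ) (n : ℕ) : √(ρ⁻¹) ^ n = ρ ^ (-((n : ℝ) / 2)) := by
  rw [Real.sqrt_eq_rpow, ← Real.rpow_natCast, ← Real.rpow_mul (by positivity), Real.inv_rpow hρ.le,
    ← Real.rpow_neg hρ.le]
  congr 1
  ring

theorem exists_rpow_le_errorProb {n k : ℕ} {v : ℝ≥0} (hv : v ≠ 0) (d : Detector n (k + 1)) :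
    ∃ c > 0, ∀ᶠ ρ in atTop, c * ρ ^ (-((n : ℝ) / 2)) ≤ errorProb v d ρ := by
  have hcard : (0 : ℝ) < (finite_messages (k + 1)).toFinset.card := by
    exact_mod_cast Finset.card_pos.2 ⟨_, (Set.Finite.mem_toFinset _).2 (one_mem_messages (k + 1))⟩
  have hg := gaussianPDFReal_pos 0 v 1 hv
  refine ⟨((finite_messages (k + 1)).toFinset.card : ℝ)⁻¹ * (gaussianPDFReal 0 v 1 * 2) ^ n *
    ((√(2 * Real.pi))⁻¹ * Real.exp (-2) * 2) ^ n, by positivity, ?_⟩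
  filter_upwards [eventually_ge_atTop 1] with ρ hρ
  have hρ0 : 0 < ρ := by linarith
  refine le_trans (le_of_eq ?_) (le_errorProb hv d hρ)
  have h1 : gaussianPDFReal 0 (Real.toNNReal ρ⁻¹) (2 * √(ρ⁻¹)) * (2 * √(ρ⁻¹)) =
      (√(2 * Real.pi))⁻¹ * Real.exp (-2) * 2 := by
    rw [gaussianPDFReal, Real.coe_toNNReal _ (by positivity), Real.sqrt_mul (by positivity),
      sub_zero, mul_pow, Real.sq_sqrt (by positivity)]
    have h2 : √(ρ⁻¹) ≠ 0 := by positivity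
    have h3 : -(2 ^ 2 * ρ⁻¹) / (2 * ρ⁻¹) = -2 := by field_simp
    rw [h3]
    field_simp
  rw [h1, ← sqrt_inv_pow_eq_rpow hρ0]
  ring

theorem ErrsOnlyIfConfused.exists_errorProb_le_rpow {n k : ℕ} (hkn : k + 1 ≤ n) {v : ℝ≥0}
    (hv : v ≠ 0) {d : Detector n (k + 1)} (hd : ErrsOnlyIfConfused d) :
    ∃ (K : ℝ) (p : ℕ), ∀ᶠ ρ in atTop,
      errorProb v d ρ ≤ K * (1 + Real.log ρ) ^ p * ρ ^ (-((n : ℝ) / 2)) := by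
  have hv0 : (0 : ℝ) < v := by exact_mod_cast pos_iff_ne_zero.2 hv
  set q : ℝ := (√(2 * Real.pi * v))⁻¹ * (2 * (4 * √n + (k + 1))) with hq
  have hq0 : 0 ≤ q := by positivity
  refine ⟨n * ((k + 1 : ℕ) * 2) + n * 2 + (k + 1).factorial * ((q ^ (k + 1)) ^ n *
    rowConst k (7 * (k + 1)) ^ k), (k + 1) * n + k, ?_⟩
  filter_upwards [eventually_ge_atTop (((32 * (7 * (k + 1)) : ℕ) : ℝ) ^ 2), eventually_ge_atTop 4,
    Real.tendsto_log_atTop.eventually_ge_atTop (n * v),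
    Real.tendsto_log_atTop.eventually_ge_atTop n] with ρ hρN hρ4 hlv hln
  have hρ0 : 0 < ρ := by linarith
  have hs2 : 2 ≤ √ρ := Real.le_sqrt_of_sq_le (by norm_num; exact hρ4)
  have hss : √ρ * √ρ = ρ := Real.mul_self_sqrt hρ0.le
  set x := Real.log ρ with hx
  have hx0 : 0 ≤ x := Real.log_nonneg (by linarith)
  set N := ⌈√ρ⌉₊ with hNdef
  have hN : 32 * (7 * (k + 1)) ≤ N := by
    have h1 : ((32 * (7 * (k + 1)) : ℕ) : ℝ) ≤ √ρ := Real.le_sqrt_of_sq_le hρN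
    exact_mod_cast h1.trans (Nat.le_ceil _)
  have hNl : √ρ ≤ N := Nat.le_ceil _
  have hNu : (N : ℝ) ≤ √ρ + 1 := (Nat.ceil_lt_add_one (Real.sqrt_nonneg _)).le
  have hNt : (N : ℝ) * √(ρ⁻¹) ≤ 2 := by
    rw [Real.sqrt_inv, ← div_eq_mul_inv, div_le_iff₀ (by positivity)]
    linarith
  set y := ρ ^ (-((n : ℝ) / 2)) with hy
  have hy0 : 0 < y := Real.rpow_pos_of_pos hρ0 _
  have hyexp : y = Real.exp (-(x * (n / 2))) := by
    rw [hy, Real.rpow_def_of_pos hρ0, ← hx]; congr 1; ring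
  have hone : 1 ≤ (1 + x) ^ ((k + 1) * n + k) := one_le_pow₀ (by linarith)
  have h := hd.errorProb_le (N := N) hkn hv hN hρ0 (M := x) (t := √(ρ⁻¹) * x) hx0 (by positivity)
  refine h.trans ?_
  have e1 : Real.exp (-x ^ 2 / (2 * v)) ≤ y := by
    rw [hyexp, Real.exp_le_exp, neg_div, neg_le_neg_iff, le_div_iff₀ (by positivity)]
    nlinarith
  have e2 : Real.exp (-(ρ * (√(ρ⁻¹) * x) ^ 2) / 2) ≤ y := by
    rw [hyexp, Real.exp_le_exp, neg_div, neg_le_neg_iff, mul_pow, Real.sq_sqrt (by positivity),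
      mul_inv_cancel_left₀ hρ0.ne']
    nlinarith
  have e3 : (√(2 * Real.pi * v))⁻¹ * (2 * (2 * N * (√n * (√(ρ⁻¹) * x)) + (k + 1) * x)) ≤
      q * (1 + x) := by
    rw [hq, mul_assoc _ _ (1 + x)]
    refine mul_le_mul_of_nonneg_left ?_ (by positivity)
    have h1 : 2 * (N : ℝ) * (√n * (√(ρ⁻¹) * x)) = 2 * √n * x * (N * √(ρ⁻¹)) := by ring
    have h2 : 2 * √n * x * ((N : ℝ) * √(ρ⁻¹)) ≤ 2 * √n * x * 2 := by gcongr
    have h3 : (4 * √n + (k + 1)) * x ≤ (4 * √n + (k + 1)) * (1 + x) := by gcongr; linarith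
    rw [h1]
    linarith
  have e4 : (((N + 1 : ℕ) : ℝ) ^ n)⁻¹ ≤ y := by
    rw [hy, ← sqrt_inv_pow_eq_rpow hρ0, Real.sqrt_inv, inv_pow]
    have : √ρ ≤ ((N + 1 : ℕ) : ℝ) := by push_cast; linarith
    gcongr
  have e5 : 1 + Real.log (N + 1 : ℕ) ≤ 1 + x := by
    rw [hx]
    gcongr
    push_cast
    nlinarith
  have hlogN : 0 ≤ 1 + Real.log (N + 1 : ℕ) := by
    have := Real.log_natCast_nonneg (N + 1)
    linarith
  calc _ ≤ n * ((k + 1 : ℕ) * (2 * y)) + n * (2 * y) + (k + 1).factorial *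
        (((q * (1 + x)) ^ (k + 1)) ^ n * y * (rowConst k (7 * (k + 1)) ^ k * (1 + x) ^ k)) := by
        gcongr
    _ = (n * ((k + 1 : ℕ) * 2) + n * 2) * 1 * y + (k + 1).factorial * ((q ^ (k + 1)) ^ n *
        rowConst k (7 * (k + 1)) ^ k) * (1 + x) ^ ((k + 1) * n + k) * y := by
        rw [mul_pow q, mul_pow (q ^ (k + 1)),
          pow_add (1 + x) ((k + 1) * n), pow_mul (1 + x)]
        ring
    _ ≤ (n * ((k + 1 : ℕ) * 2) + n * 2) * (1 + x) ^ ((k + 1) * n + k) * y +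
        (k + 1).factorial * ((q ^ (k + 1)) ^ n *
        rowConst k (7 * (k + 1)) ^ k) * (1 + x) ^ ((k + 1) * n + k) * y := by
        gcongr
    _ = _ := by ring

theorem ErrsOnlyIfConfused.tendsto_log_errorProb_div_log {n m : ℕ} (hm : 1 ≤ m) (hmn : m ≤ n)
    {v : ℝ≥0} (hv : v ≠ 0) {d : Detector n m} (hd : ErrsOnlyIfConfused d) :
    Tendsto (fun ρ : ℝ => Real.log (errorProb v d ρ) / Real.log ρ) atTop (𝓝 (-(n : ℝ) / 2)) := by
  obtain ⟨k, rfl⟩ : ∃ k, m = k + 1 := ⟨m - 1, by omega⟩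
  obtain ⟨c, hc, hlow⟩ := exists_rpow_le_errorProb hv d
  obtain ⟨K, p, hup⟩ := hd.exists_errorProb_le_rpow hmn hv
  rw [neg_div]
  exact tendsto_log_div_log_of_bounds hc hlow hup

theorem theorem1 (n m : ℕ) (hm : 1 ≤ m) (hmn : m ≤ n) (v : ℝ≥0) (hv : v ≠ 0)
    (dSDR dML : Detector n m) (hSDR : IsSDRDetector dSDR) (hML : IsMLDetector dML) :
    Tendsto (fun ρ : ℝ => Real.log (errorProb v dSDR ρ) / Real.log ρ) atTop (𝓝 (-(n : ℝ) / 2)) ∧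
    Tendsto (fun ρ : ℝ => Real.log (errorProb v dML ρ) / Real.log ρ) atTop (𝓝 (-(n : ℝ) / 2)) :=
  ⟨hSDR.errsOnlyIfConfused.tendsto_log_errorProb_div_log hm hmn hv,
    hML.errsOnlyIfConfused.tendsto_log_errorProb_div_log hm hmn hv⟩
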